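/- Let $\alpha,\gamma>0$, $a\in C^7[0,1]$, $b,f\in C^9[0,1]$ with $a(x)>\alpha$ and $b(x)>\gamma a(x)$ for $x\in(0,1)$. For $0<\varepsilon\le 1$, $0\le\mu\le 1$ put \[ L_{\varepsilon,\mu}z=-\varepsilon z''+\mu a z'+bz,\qquad \theta=\max\Bigl\{1,\frac{\alpha\mu^2}{\gamma\varepsilon}\Bigr\},\qquad \rho_L=\max\Bigl\{1,\tfrac12\sqrt{\tfrac{\gamma\alpha}{\theta\varepsilon}}\Bigr\},\qquad \rho_R=\max\Bigl\{1,\sqrt{\tfrac{\theta\gamma\alpha}{\varepsilon}}\Bigr\}. \] A function $v\in C^5[0,1]$ is called a regular component with constant $K$ if $L_{\varepsilon,\mu}v=f$ on $(0,1)$ and its boundary values $v(0),v(1)$ are such that \[ \max_{[0,1]}|v^{(k)}|\le K\Bigl(1+\bigl(\sqrt{\varepsilon/\theta}\bigr)^{3-k}\Bigr),\qquad 0\le k\le 5. \] For $N\ge 4$ divisible by $4$ let \[ \sigma_L=\min\Bigl\{\tfrac14,\tfrac{2}{\rho_L}\ln N\Bigr\},\qquad \sigma_R=\min\Bigl\{\tfrac14,\tfrac{4}{\rho_R}\ln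 N\Bigr\}, \] and let $0=x_0<x_1<\dots<x_N=1$ be the mesh that divides $[0,\sigma_L]$, $[\sigma_L,1-\sigma_R]$, $[1-\sigma_R,1]$ uniformly into $N/4$, $N/2$, $N/4$ intervals. With $h_i=x_i-x_{i-1}$ let \[ D^-Z(x_i)=\frac{Z(x_i)-Z(x_{i-1})}{h_i},\quad D^+Z(x_i)=\frac{Z(x_{i+1})-Z(x_i)}{h_{i+1}},\quad \delta^2Z(x_i)=\frac{D^+Z(x_i)-D^-Z(x_i)}{(x_{i+1}-x_{i-1})/2}. \] The discrete regular component $V$ belonging to $v$ is the mesh function with $(-\varepsilon\delta^2+\mu aD^-+b)V(x_i)=f(x_i)$ for $0<i<N$, $V(x_0)=v(0)$, $V(x_N)=v(1)$. Then the following holds. (1) There is a constant $K$, independent of $\varepsilon$ and $\mu$, such that a regular component $v$ with constant $K$ exists for all $0<\varepsilon\le1$, $0\le\mu\le1$. (2) For every $K$ there is a constant $C$, independent of $\varepsilon$, $\mu$, $v$ and $N$, such that, whenever $v$ is a regular component with constant $K$ and $\sigma_R\le\sigma_L<1/4$, the discrete regular component $V$ exists and, for $1\le i\le N$, \[ |D^-(V-v)(x_i)|\le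 CN^{-1}\quad\text{if } x_i\le\sigma_L, \] \[ |D^-(V-v)(x_i)|\le CN^{-1}(\ln N)^2\quad\text{if } \sigma_L<x_i\le 1-\sigma_R, \] \[ \sqrt{\frac{\varepsilon}{\theta}}\;|D^-(V-v)(x_i)|\le CN^{-1}(\ln N)^2\quad\text{if } x_i>1-\sigma_R. \] -/

import Mathlib

open Set

noncomputable section

namespace TwoParam

/-- `θ = max {1, α μ² / (γ ε)}`. -/
def theta (α γ ε μ : ℝ) : ℝ := max 1 (α * μ ^ 2 / (γ * ε))

/-- Decay rate of the left layer, `ρ_L = max {1, ½ √(γ α / (θ ε))}`. -/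
def rhoL (α γ ε μ : ℝ) : ℝ := max 1 (1 / 2 * Real.sqrt (γ * α / (theta α γ ε μ * ε)))

/-- Decay rate of the right layer, `ρ_R = max {1, √(θ γ α / ε)}`. -/
def rhoR (α γ ε μ : ℝ) : ℝ := max 1 (Real.sqrt (theta α γ ε μ * γ * α / ε))

/-- Left transition parameter of the Shishkin mesh. -/
def sigmaL (α γ ε μ : ℝ) (N : ℕ) : ℝ := min (1 / 4) (2 / rhoL α γ ε μ * Real.log N)

/-- Right transition parameter of the Shishkin mesh. -/
def sigmaR (α γ ε μ : ℝ) (N : ℕ) : ℝ := min (1 / 4) (4 / rhoR α γ ε μ * Real.log N)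

/-- The differential operator `L z = -ε z'' + μ a z' + b z` on `[0, 1]`. -/
def diffOp (a b : ℝ → ℝ) (ε μ : ℝ) (z : ℝ → ℝ) (x : ℝ) : ℝ :=
  -ε * iteratedDerivWithin 2 z (Icc 0 1) x + μ * a x * iteratedDerivWithin 1 z (Icc 0 1) x
    + b x * z x

/-- `v` is a regular component of the solution (with constant `K`): it solves `L v = f` in `(0, 1)`
and its boundary values are such that `|v|_k ≤ K (1 + (√(ε / θ)) ^ (3 - k))` for `0 ≤ k ≤ 5`,
where `|v|_k` is the maximum of the modulus of the `k`-th derivative on `[0, 1]`. -/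
structure IsRegularComponent (a b f : ℝ → ℝ) (α γ ε μ K : ℝ) (v : ℝ → ℝ) : Prop where
  contDiffOn : ContDiffOn ℝ 5 v (Icc 0 1)
  eqn : ∀ x ∈ Ioo (0 : ℝ) 1, diffOp a b ε μ v x = f x
  bound : ∀ k : ℕ, k ≤ 5 → ∀ x ∈ Icc (0 : ℝ) 1,
    |iteratedDerivWithin k v (Icc 0 1) x|
      ≤ K * (1 + Real.sqrt (ε / theta α γ ε μ) ^ ((3 : ℤ) - (k : ℤ)))

/-- The mesh points `x_i`, `0 ≤ i ≤ N`, of the piecewise uniform mesh with `N / 4` equal intervals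
in `[0, sL]`, `N / 2` in `[sL, 1 - sR]` and `N / 4` in `[1 - sR, 1]` (for `4 ∣ N`). -/
def meshPoint (sL sR : ℝ) (N i : ℕ) : ℝ :=
  if 4 * i ≤ N then (i : ℝ) * (4 * sL / N)
  else if 4 * i ≤ 3 * N then sL + ((i : ℝ) - N / 4) * (2 * (1 - sL - sR) / N)
  else 1 - ((N : ℝ) - i) * (4 * sR / N)

/-- The Shishkin mesh of the two-parameter problem. -/
def shishkin (α γ ε μ : ℝ) (N : ℕ) : ℕ → ℝ :=
  meshPoint (sigmaL α γ ε μ N) (sigmaR α γ ε μ N) N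

/-- Backward difference `D⁻ Z (x_i)`, used for `1 ≤ i`. -/
def dMinus (x Z : ℕ → ℝ) (i : ℕ) : ℝ := (Z i - Z (i - 1)) / (x i - x (i - 1))

/-- Forward difference `D⁺ Z (x_i)`. -/
def dPlus (x Z : ℕ → ℝ) (i : ℕ) : ℝ := (Z (i + 1) - Z i) / (x (i + 1) - x i)

/-- Second difference `δ² Z (x_i)` on a nonuniform mesh, used for `1 ≤ i`. -/
def delta2 (x Z : ℕ → ℝ) (i : ℕ) : ℝ :=
  (dPlus x Z i - dMinus x Z i) / ((x (i + 1) - x (i - 1)) / 2)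

/-- The upwind operator `L^N Z = -ε δ² Z + μ a D⁻ Z + b Z` at `x_i`. -/
def upwindOp (a b : ℝ → ℝ) (ε μ : ℝ) (x Z : ℕ → ℝ) (i : ℕ) : ℝ :=
  -ε * delta2 x Z i + μ * a (x i) * dMinus x Z i + b (x i) * Z i

/-- `V` (a mesh function, of which only the values at `0 ≤ i ≤ N` matter) is the discrete regular
component: `L^N V = f` at the interior mesh points, `V = v` at the two end points. -/
structure IsDiscreteRegularComponent (a b f : ℝ → ℝ) (ε μ : ℝ) (N : ℕ) (x : ℕ → ℝ)
    (v : ℝ → ℝ) (V : ℕ → ℝ) : Prop where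
  eqn : ∀ i : ℕ, 0 < i → i < N → upwindOp a b ε μ x V i = f (x i)
  left : V 0 = v 0
  right : V N = v 1

end TwoParam

end

/-! Existence. Division by `a` gives `-ε P v'' + μ v' + Q v = G` with `P = 1/a`, `Q = b/a`, `G =
f/a` and a constant convection coefficient. The coefficients are extended to `[-1, 2]` so that `P =
1`, `Q = γ`, `G = 0` near the ends. There the Robin condition `v' = λ v`, with `λ` a characteristic
root of the constant-coefficient equation, is inherited by all derivatives. Every derivative of `v`
then solves an equation of the same type with controlled right side, and a maximum principle with
Robin conditions bounds derivatives up to order five uniformly in `ε` and `μ`. The restriction to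
`[0, 1]` is the regular component (`exists_robin_solution_bound`, `exists_regular_component`).

Error. Let `e = V - v` and `s = √(ε/θ)`. Consistency and the discrete maximum principle bound both
`e` and its upwind residual by a multiple of `N⁻¹(ε + μ)`. On a uniform mesh piece of length at
least a multiple of `s`, a discrete Landau inequality turns this into `|D⁻e| ≤ C N⁻¹(ε + μ)/s`. On
the right piece this is the third estimate. If `θ = 1`, then `s² = ε` and `(ε + μ)/s` is bounded, so
all pieces are settled. Otherwise `s` is a multiple of `ε/μ`, and the equation is read as a
recursion for `D⁻e` from right to left, whose multipliers are at most `1/(1 + μαk/ε)` with `k` the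
mean of two adjacent steps. The fine steps damp by a factor of order `1/N`, and the single step at
the transition point by a factor of order `Nε/μ`; their product cancels the `μ/ε` of the right
layer, and further left nothing grows (`abs_dMinus_le_of_convection`).

The logarithms in the statement are not needed: they enter only through `ln N ≥ 1`. -/

namespace TwoParam

/-! ### A Landau inequality for difference quotients -/

/-- Discrete Landau inequality on a uniform mesh: differences of a bounded mesh function are bounded
if their increments are. -/
theorem abs_le_of_bounded_increments {d e : ℕ → ℝ} {p n : ℕ} {h w P G E : ℝ} (hh : 0 < h)
    (hw : 0 < w) (hwn : w ≤ n * h) (hP : 0 ≤ P) (hG : 0 ≤ G) (hPw : P * w ≤ 1 / 4)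
    (he : ∀ j, p ≤ j → j ≤ p + n → |e j| ≤ E)
    (hde : ∀ j, p < j → j ≤ p + n → e j - e (j - 1) = h * d j)
    (hd : ∀ j, p < j → j < p + n → |d (j + 1) - d j| ≤ h * (P * |d j| + G)) :
    ∀ j, p < j → j ≤ p + n → |d j| ≤ 8 * (E / w + G * w) := by
  have hE : 0 ≤ E := (abs_nonneg _).trans (he p le_rfl (by omega))
  intro j0 hj0 hj0'
  obtain ⟨i, hi, hmax⟩ := Finset.exists_max_image (Finset.Ioc p (p + n)) (fun j => |d j|)
    ⟨j0, Finset.mem_Ioc.2 ⟨hj0, hj0'⟩⟩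
  rw [Finset.mem_Ioc] at hi
  refine (hmax j0 (Finset.mem_Ioc.2 ⟨hj0, hj0'⟩)).trans ?_
  set D := |d i| with hD
  have hDle : ∀ j, p < j → j ≤ p + n → |d j| ≤ D := fun j h1 h2 =>
    hmax j (Finset.mem_Ioc.2 ⟨h1, h2⟩)
  have hD0 : 0 ≤ D := abs_nonneg _
  have hEw : 0 ≤ E / w := by positivity
  -- If a single step is longer than `w`, one increment already gives `h D ≤ 2E`. Otherwise a window
  -- of `m` steps with `w/2 ≤ m h ≤ w` is used.
  rcases lt_or_ge w h with hwh | hwh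
  · have h1 := hde i hi.1 hi.2
    have h2 : h * D ≤ 2 * E := by
      rw [hD, ← abs_of_pos hh, ← abs_mul, ← h1]
      have := abs_sub (e i) (e (i - 1))
      have h3 := he i hi.1.le hi.2
      have h4 := he (i - 1) (by omega) (by omega)
      linarith
    have h3 : w * D ≤ 2 * E := (mul_le_mul_of_nonneg_right hwh.le hD0).trans h2
    have h4 : D ≤ 2 * (E / w) := by
      rw [← mul_div_assoc, le_div_iff₀ hw]; linarith
    have : 0 ≤ G * w := by positivity
    linarith
  · set m := ⌊w / h⌋₊ with hm
    have hm1 : 1 ≤ m := Nat.le_floor (by rw [le_div_iff₀ hh]; simpa using hwh)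
    have hmw : m * h ≤ w := by
      rw [← le_div_iff₀ hh]; exact Nat.floor_le (by positivity)
    have hmw2 : w ≤ 2 * (m * h) := by
      have h1 : w / h < m + 1 := Nat.lt_floor_add_one _
      rw [div_lt_iff₀ hh] at h1
      have : (1 : ℝ) ≤ m := by exact_mod_cast hm1
      nlinarith
    have hmn : m ≤ n := by
      have : (m : ℝ) * h ≤ n * h := hmw.trans hwn
      exact_mod_cast le_of_mul_le_mul_right this hh
    set S := h * (P * D + G) with hS
    have hS0 : 0 ≤ S := by positivity
    have hvar : ∀ k j, p < j → j + k ≤ p + n → |d (j + k) - d j| ≤ k * S := by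
      intro k
      induction k with
      | zero => intro j _ _; simp
      | succ k ih =>
        intro j h1 h2
        have h3 := ih j h1 (by omega)
        have h4 := hd (j + k) (by omega) (by omega)
        have h5 : h * (P * |d (j + k)| + G) ≤ S := by
          have := hDle (j + k) (by omega) (by omega)
          rw [hS]
          gcongr
        have h6 := abs_sub_le (d (j + (k + 1))) (d (j + k)) (d j)
        rw [← add_assoc] at h6 ⊢
        push_cast
        linarith
    -- Here `P w ≤ 1/4` enters: across the window `d` changes by at most a quarter of its maximum,
    -- plus `w G`, so summing increments recovers most of `D`.
    have hSm : m * S ≤ D / 4 + w * G := by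
      have h1 : m * S = (m * h) * (P * D + G) := by rw [hS]; ring
      have h2 : (m * h) * (P * D + G) ≤ w * (P * D + G) := by gcongr
      nlinarith
    -- The window must contain the maximizer `i` without leaving the piece; it starts at `i - 1`
    -- unless that would overrun the right end.
    obtain ⟨q, hq1, hq2, hq3, hq4⟩ : ∃ q, p ≤ q ∧ q + m ≤ p + n ∧ q < i ∧ i ≤ q + m := by
      refine ⟨min (i - 1) (p + n - m), ?_, ?_, ?_, ?_⟩ <;> omega
    have hwin : ∀ j, q < j → j ≤ q + m → |d j - d i| ≤ D / 4 + w * G := by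
      intro j h1 h2
      refine le_trans ?_ hSm
      rcases le_total i j with hij | hij
      · obtain ⟨k, rfl⟩ := Nat.exists_eq_add_of_le hij
        refine (hvar k i hi.1 (by omega)).trans ?_
        gcongr; omega
      · obtain ⟨k, hk⟩ := Nat.exists_eq_add_of_le hij
        have := hvar k j (by omega) (by omega)
        rw [← hk, abs_sub_comm] at this
        refine this.trans ?_
        gcongr; omega
    have hsum : ∀ k, k ≤ m → |e (q + k) - e q - k * h * d i| ≤ k * h * (D / 4 + w * G) := by
      intro k
      induction k with
      | zero => intro _; simp
      | succ k ih =>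
        intro hk
        have h1 := ih (by omega)
        have h2 := hde (q + (k + 1)) (by omega) (by omega)
        have h3 := hwin (q + (k + 1)) (by omega) (by omega)
        have h4 : e (q + (k + 1)) - e q - ((k + 1 : ℕ) : ℝ) * h * d i
            = (e (q + k) - e q - k * h * d i) + h * (d (q + (k + 1)) - d i) := by
          have : q + (k + 1) - 1 = q + k := by omega
          rw [this] at h2
          push_cast
          linear_combination h2
        rw [h4]
        refine (abs_add_le _ _).trans ?_
        rw [abs_mul, abs_of_pos hh]
        push_cast
        nlinarith [mul_le_mul_of_nonneg_left h3 hh.le]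
    have h1 := hsum m le_rfl
    have h2 : |(m : ℝ) * h * d i| ≤ 2 * E + m * h * (D / 4 + w * G) := by
      have h3 := he (q + m) (by omega) (by omega)
      have h4 := he q (by omega) (by omega)
      rw [abs_le] at h1 h3 h4 ⊢
      constructor <;> linarith
    have hmh : 0 < (m : ℝ) * h := by positivity
    rw [abs_mul, abs_of_pos hmh, ← hD] at h2
    have h3 : m * h * (3 / 4 * D - w * G) ≤ 2 * E := by linarith
    by_contra hcon
    push Not at hcon
    have hGw : 0 ≤ w * G := by positivity
    have h5 : 6 * (E / w) < 3 / 4 * D - w * G := by linarith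
    have h6 : m * h * (6 * (E / w)) ≤ m * h * (3 / 4 * D - w * G) := by gcongr
    have h7 : w / 2 * (6 * (E / w)) ≤ m * h * (6 * (E / w)) := by gcongr; linarith
    have h8 : w / 2 * (6 * (E / w)) = 3 * E := by field_simp; ring
    have h9 : m * h * (6 * (E / w)) < m * h * (3 / 4 * D - w * G) := by gcongr
    linarith

/-! ### Discrete maximum principle and solvability of the upwind scheme -/

theorem dPlus_eq_dMinus (x Z : ℕ → ℝ) (i : ℕ) : dPlus x Z i = dMinus x Z (i + 1) := rfl

/-- Discrete maximum principle, one-sided. -/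
theorem upwind_le {a b : ℝ → ℝ} {ε μ β T : ℝ} {N : ℕ} {x e : ℕ → ℝ} (hε : 0 < ε) (hμ : 0 ≤ μ)
    (hβ : 0 < β) (hT : 0 ≤ T) (hx : ∀ i < N, x i < x (i + 1))
    (ha : ∀ i, 0 < i → i < N → 0 ≤ a (x i)) (hb : ∀ i, 0 < i → i < N → β ≤ b (x i))
    (h0 : e 0 ≤ 0) (hN : e N ≤ 0) (hL : ∀ i, 0 < i → i < N → upwindOp a b ε μ x e i ≤ T) :
    ∀ i ≤ N, e i ≤ T / β := by
  intro i0 hi0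
  obtain ⟨i, hi, hmax⟩ := Finset.exists_max_image (Finset.range (N + 1)) e ⟨0, by simp⟩
  refine (hmax i0 (by simp; omega)).trans ?_
  have hTβ : 0 ≤ T / β := by positivity
  rcases lt_or_ge 0 (e i) with hpos | hneg
  swap
  · linarith
  have hi1 : 0 < i := by
    rcases Nat.eq_zero_or_pos i with h | h
    · subst h; linarith
    · exact h
  have hi2 : i < N := by
    have : i ≤ N := by simp at hi; omega
    rcases this.eq_or_lt with h | h
    · subst h; linarith
    · exact h
  obtain ⟨k, rfl⟩ : ∃ k, i = k + 1 := ⟨i - 1, by omega⟩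
  have hx1 := hx k (by omega)
  have hx2 := hx (k + 1) hi2
  -- At a maximum the backward difference has the sign of the nonnegative convection coefficient, so
  -- no restriction on the mesh size is needed.
  have hm : 0 ≤ dMinus x e (k + 1) := by
    have := hmax k (by simp; omega)
    exact div_nonneg (by simpa using this) (by simpa using hx1.le)
  have hp : dPlus x e (k + 1) ≤ 0 := by
    have := hmax (k + 1 + 1) (by simp; omega)
    exact div_nonpos_of_nonpos_of_nonneg (by linarith) (by linarith)
  have h2 : delta2 x e (k + 1) ≤ 0 :=
    div_nonpos_of_nonpos_of_nonneg (by linarith) (by simp; linarith)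
  have h3 := hL (k + 1) hi1 hi2
  unfold upwindOp at h3
  have h4 : 0 ≤ μ * a (x (k + 1)) * dMinus x e (k + 1) :=
    mul_nonneg (mul_nonneg hμ (ha _ hi1 hi2)) hm
  have h5 : 0 ≤ -ε * delta2 x e (k + 1) := by nlinarith
  have h6 : β * e (k + 1) ≤ b (x (k + 1)) * e (k + 1) := by
    gcongr; exact hb _ hi1 hi2
  rw [le_div_iff₀ hβ]
  linarith

theorem upwindOp_add_smul (a b : ℝ → ℝ) (ε μ c : ℝ) (x Y Z : ℕ → ℝ) (i : ℕ) :
    upwindOp a b ε μ x (fun j => Y j + c * Z j) i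
      = upwindOp a b ε μ x Y i + c * upwindOp a b ε μ x Z i := by
  unfold upwindOp delta2 dPlus dMinus
  ring

theorem upwind_abs_le {a b : ℝ → ℝ} {ε μ β T : ℝ} {N : ℕ} {x e : ℕ → ℝ} (hε : 0 < ε) (hμ : 0 ≤ μ)
    (hβ : 0 < β) (hT : 0 ≤ T) (hx : ∀ i < N, x i < x (i + 1))
    (ha : ∀ i, 0 < i → i < N → 0 ≤ a (x i)) (hb : ∀ i, 0 < i → i < N → β ≤ b (x i))
    (h0 : e 0 = 0) (hN : e N = 0) (hL : ∀ i, 0 < i → i < N → |upwindOp a b ε μ x e i| ≤ T) :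
    ∀ i ≤ N, |e i| ≤ T / β := by
  intro i hi
  rw [abs_le']
  refine ⟨upwind_le hε hμ hβ hT hx ha hb h0.le hN.le (fun i h1 h2 => (abs_le.1 (hL i h1 h2)).2) i hi,
    ?_⟩
  refine upwind_le (e := fun j => -e j) hε hμ hβ hT hx ha hb (by simp [h0]) (by simp [hN])
    (fun i h1 h2 => ?_) i hi
  have h3 : upwindOp a b ε μ x (fun j => -e j) i = -upwindOp a b ε μ x e i := by
    unfold upwindOp delta2 dPlus dMinus
    ring
  rw [h3]
  linarith [(abs_le.1 (hL i h1 h2)).1]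

/-- The upwind equation as a recursion for backward differences. -/
theorem dMinus_succ_sub {a b : ℝ → ℝ} {ε μ : ℝ} {x e : ℕ → ℝ} {i : ℕ} (hε : ε ≠ 0)
    (hx : x (i + 1) - x (i - 1) ≠ 0) :
    dMinus x e (i + 1) - dMinus x e i = (x (i + 1) - x (i - 1)) / 2 / ε *
      (μ * a (x i) * dMinus x e i + b (x i) * e i - upwindOp a b ε μ x e i) := by
  rw [upwindOp, delta2, dPlus_eq_dMinus]
  field_simp
  ring

/-- The upwind equation solved as an initial value problem. -/
theorem exists_upwind_shooting (a b : ℝ → ℝ) {ε : ℝ} (μ : ℝ) {N : ℕ} {x : ℕ → ℝ} (hε : ε ≠ 0)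
    (hx : ∀ i < N, x i < x (i + 1)) (F : ℕ → ℝ) (A c : ℝ) :
    ∃ V : ℕ → ℝ, V 0 = A ∧ V 1 = c ∧ ∀ i, 0 < i → i < N → upwindOp a b ε μ x V i = F i := by
  let next : ℕ → ℝ × ℝ → ℝ := fun k y =>
    y.2 + (x (k + 2) - x (k + 1)) * ((y.2 - y.1) / (x (k + 1) - x k)
      + (x (k + 2) - x k) / 2 / ε * (μ * a (x (k + 1)) * ((y.2 - y.1) / (x (k + 1) - x k))
        + b (x (k + 1)) * y.2 - F (k + 1)))
  -- The state at `k` is the pair of mesh values at `k` and `k + 1`.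
  let W : ℕ → ℝ × ℝ := fun k => Nat.rec (A, c) (fun k y => (y.2, next k y)) k
  have hW : ∀ k, (W k).2 = (W (k + 1)).1 := fun k => rfl
  have hW2 : ∀ k, (W (k + 1)).2 = next k (W k) := fun k => rfl
  refine ⟨fun k => (W k).1, rfl, rfl, ?_⟩
  intro i hi hiN
  obtain ⟨k, rfl⟩ : ∃ k, i = k + 1 := ⟨i - 1, by omega⟩
  have hx1 := hx k (by omega)
  have hx2 := hx (k + 1) hiN
  have e1 : (W (k + 2)).1 = next k ((W k).1, (W (k + 1)).1) := by
    rw [← hW (k + 1), hW2, ← hW k]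
  have n1 : x (k + 1) - x k ≠ 0 := by linarith
  have n2 : x (k + 1 + 1) - x (k + 1) ≠ 0 := by linarith
  have n3 : x (k + 1 + 1) - x k ≠ 0 := by linarith
  simp only [upwindOp, delta2, dPlus, dMinus, Nat.add_sub_cancel]
  rw [show k + 1 + 1 = k + 2 from rfl, e1]
  rw [show k + 1 + 1 = k + 2 from rfl] at n2 n3
  simp only [next]
  field_simp
  ring

/-- Linear shooting: a particular solution is corrected by a multiple of the homogeneous solution
with values `0, 1` at the first two nodes. If the latter vanished at `N`, the maximum principle with
zero residual would force its value `1` to be `0`. -/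
theorem exists_upwind_solution {a b : ℝ → ℝ} {ε μ β : ℝ} {N : ℕ} {x : ℕ → ℝ} (hε : 0 < ε)
    (hμ : 0 ≤ μ) (hN : 0 < N) (hβ : 0 < β) (hx : ∀ i < N, x i < x (i + 1))
    (ha : ∀ i, 0 < i → i < N → 0 ≤ a (x i)) (hb : ∀ i, 0 < i → i < N → β ≤ b (x i))
    (F : ℕ → ℝ) (A B : ℝ) :
    ∃ V : ℕ → ℝ, (∀ i, 0 < i → i < N → upwindOp a b ε μ x V i = F i) ∧ V 0 = A ∧ V N = B := by
  obtain ⟨Y, hY0, -, hY⟩ := exists_upwind_shooting a b μ hε.ne' hx F A 0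
  obtain ⟨Z, hZ0, hZ1, hZ⟩ := exists_upwind_shooting a b μ hε.ne' hx (fun _ => 0) 0 1
  have hZN : Z N ≠ 0 := by
    intro h
    have := upwind_abs_le hε hμ hβ le_rfl hx ha hb hZ0 h
      (fun i h1 h2 => by rw [hZ i h1 h2]; simp) 1 hN
    rw [hZ1] at this
    norm_num at this
  refine ⟨fun j => Y j + (B - Y N) / Z N * Z j, fun i h1 h2 => ?_, ?_, ?_⟩
  · rw [upwindOp_add_smul, hY i h1 h2, hZ i h1 h2]; simp
  · simp [hY0, hZ0]
  · simp only; field_simp; ring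

/-! ### Taylor estimates and consistency -/

theorem abs_sub_le_mul_of_deriv {f f' : ℝ → ℝ} {x y C : ℝ}
    (hf : ∀ t ∈ uIcc x y, HasDerivWithinAt f (f' t) (uIcc x y) t)
    (hC : ∀ t ∈ uIcc x y, |f' t| ≤ C) : |f y - f x| ≤ C * |y - x| := by
  have := (convex_uIcc x y).norm_image_sub_le_of_norm_hasDerivWithin_le (f := f) (f' := f') (C := C)
    (fun t ht => hf t ht) (fun t ht => hC t ht) left_mem_uIcc right_mem_uIcc
  simpa using this

/-- The unordered interval `uIcc` serves both neighbours of a mesh point at once. Integrating a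
bound on the derivative of the remainder by the mean value inequality gives constants without
factorials, which suffices. -/
theorem abs_taylor_one_le {v v1 v2 : ℝ → ℝ} {x y M : ℝ}
    (h0 : ∀ t ∈ uIcc x y, HasDerivWithinAt v (v1 t) (uIcc x y) t)
    (h1 : ∀ t ∈ uIcc x y, HasDerivWithinAt v1 (v2 t) (uIcc x y) t)
    (hM : ∀ t ∈ uIcc x y, |v2 t| ≤ M) :
    |v y - v x - v1 x * (y - x)| ≤ M * |y - x| ^ 2 := by
  have hM0 : 0 ≤ M := (abs_nonneg _).trans (hM x left_mem_uIcc)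
  have key : ∀ t ∈ uIcc x y, |v1 t - v1 x| ≤ M * |y - x| := by
    intro t ht
    have hsub : uIcc x t ⊆ uIcc x y := uIcc_subset_uIcc_left ht
    refine (abs_sub_le_mul_of_deriv (fun r hr => (h1 r (hsub hr)).mono hsub)
      (fun r hr => hM r (hsub hr))).trans ?_
    exact mul_le_mul_of_nonneg_left (abs_sub_left_of_mem_uIcc ht) hM0
  have h2 := abs_sub_le_mul_of_deriv (f := fun t => v t - v1 x * t) (f' := fun t => v1 t - v1 x)
    (x := x) (y := y) (C := M * |y - x|)
    (fun t ht => (h0 t ht).sub (by simpa using (hasDerivWithinAt_id t _).const_mul (v1 x))) key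
  calc _ = |v y - v1 x * y - (v x - v1 x * x)| := by ring_nf
    _ ≤ _ := h2
    _ = _ := by ring

theorem abs_taylor_two_le {v v1 v2 v3 : ℝ → ℝ} {x y M : ℝ}
    (h0 : ∀ t ∈ uIcc x y, HasDerivWithinAt v (v1 t) (uIcc x y) t)
    (h1 : ∀ t ∈ uIcc x y, HasDerivWithinAt v1 (v2 t) (uIcc x y) t)
    (h2 : ∀ t ∈ uIcc x y, HasDerivWithinAt v2 (v3 t) (uIcc x y) t)
    (hM : ∀ t ∈ uIcc x y, |v3 t| ≤ M) :
    |v y - v x - v1 x * (y - x) - v2 x * (y - x) ^ 2 / 2| ≤ M * |y - x| ^ 3 := by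
  have hM0 : 0 ≤ M := (abs_nonneg _).trans (hM x left_mem_uIcc)
  have key : ∀ t ∈ uIcc x y, |v1 t - v1 x - v2 x * (t - x)| ≤ M * |y - x| ^ 2 := by
    intro t ht
    have hsub : uIcc x t ⊆ uIcc x y := uIcc_subset_uIcc_left ht
    refine (abs_taylor_one_le (fun r hr => (h1 r (hsub hr)).mono hsub)
      (fun r hr => (h2 r (hsub hr)).mono hsub) (fun r hr => hM r (hsub hr))).trans ?_
    exact mul_le_mul_of_nonneg_left
      (pow_le_pow_left₀ (abs_nonneg _) (abs_sub_left_of_mem_uIcc ht) 2) hM0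
  have h3 := abs_sub_le_mul_of_deriv (f := fun t => v t - v1 x * t - v2 x * ((t - x) ^ 2 / 2))
    (f' := fun t => v1 t - v1 x - v2 x * (t - x))
    (x := x) (y := y) (C := M * |y - x| ^ 2)
    (fun t ht => ((h0 t ht).sub (by simpa using (hasDerivWithinAt_id t _).const_mul (v1 x))).sub
      (HasDerivWithinAt.const_mul _ (by
        have := (((hasDerivWithinAt_id t (uIcc x y)).sub_const x).pow 2).div_const 2
        simpa using this))) key
  calc _ = |v y - v1 x * y - v2 x * ((y - x) ^ 2 / 2)
        - (v x - v1 x * x - v2 x * ((x - x) ^ 2 / 2))| := by ring_nf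
    _ ≤ _ := h3
    _ = _ := by ring

theorem hasDerivWithinAt_iteratedDerivWithin {v : ℝ → ℝ} {n k : ℕ}
    (hv : ContDiffOn ℝ n v (Icc 0 1)) (hk : k < n) {s : Set ℝ} (hs : s ⊆ Icc 0 1) {t : ℝ}
    (ht : t ∈ Icc (0 : ℝ) 1) :
    HasDerivWithinAt (iteratedDerivWithin k v (Icc 0 1))
      (iteratedDerivWithin (k + 1) v (Icc 0 1) t) s t := by
  have hu : UniqueDiffOn ℝ (Icc (0 : ℝ) 1) := uniqueDiffOn_Icc one_pos
  rw [iteratedDerivWithin_succ]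
  exact ((hv.differentiableOn_iteratedDerivWithin (by exact_mod_cast hk) hu) t ht
    |>.hasDerivWithinAt).mono hs

/-- Consistency of the upwind operator. -/
theorem abs_diffOp_sub_upwindOp_le {a b v : ℝ → ℝ} {ε μ A M H : ℝ} {x : ℕ → ℝ} {i : ℕ}
    (hε : 0 < ε) (hμ : 0 ≤ μ) (hv : ContDiffOn ℝ 5 v (Icc 0 1)) (ha : |a (x i)| ≤ A)
    (hx0 : 0 ≤ x (i - 1)) (hx1 : x (i - 1) < x i) (hx2 : x i < x (i + 1)) (hx3 : x (i + 1) ≤ 1)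
    (hH1 : x i - x (i - 1) ≤ H) (hH2 : x (i + 1) - x i ≤ H)
    (hM2 : ∀ t ∈ Icc (0 : ℝ) 1, |iteratedDerivWithin 2 v (Icc 0 1) t| ≤ M)
    (hM3 : ∀ t ∈ Icc (0 : ℝ) 1, |iteratedDerivWithin 3 v (Icc 0 1) t| ≤ M) :
    |diffOp a b ε μ v (x i) - upwindOp a b ε μ x (fun j => v (x j)) i|
      ≤ M * H * (4 + A) * (ε + μ) := by
  have hM : 0 ≤ M := (abs_nonneg _).trans (hM2 0 (by simp))
  have hA : 0 ≤ A := (abs_nonneg _).trans ha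
  have hxi : x i ∈ Icc (0 : ℝ) 1 := ⟨by linarith, by linarith⟩
  have hsub : ∀ y ∈ Icc (0 : ℝ) 1, uIcc (x i) y ⊆ Icc 0 1 := fun y hy => uIcc_subset_Icc hxi hy
  set v1 := iteratedDerivWithin 1 v (Icc 0 1)
  set v2 := iteratedDerivWithin 2 v (Icc 0 1)
  set v3 := iteratedDerivWithin 3 v (Icc 0 1)
  have d0 : ∀ y ∈ Icc (0 : ℝ) 1, ∀ t ∈ uIcc (x i) y, HasDerivWithinAt v (v1 t) (uIcc (x i) y) t := by
    intro y hy t ht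
    have := hasDerivWithinAt_iteratedDerivWithin (n := 5) (k := 0) hv (by norm_num) (hsub y hy)
      (hsub y hy ht)
    rwa [iteratedDerivWithin_zero] at this
  have d1 : ∀ y ∈ Icc (0 : ℝ) 1, ∀ t ∈ uIcc (x i) y,
      HasDerivWithinAt v1 (v2 t) (uIcc (x i) y) t := fun y hy t ht =>
    hasDerivWithinAt_iteratedDerivWithin (n := 5) (k := 1) hv (by norm_num) (hsub y hy)
      (hsub y hy ht)
  have d2 : ∀ y ∈ Icc (0 : ℝ) 1, ∀ t ∈ uIcc (x i) y,
      HasDerivWithinAt v2 (v3 t) (uIcc (x i) y) t := fun y hy t ht =>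
    hasDerivWithinAt_iteratedDerivWithin (n := 5) (k := 2) hv (by norm_num) (hsub y hy)
      (hsub y hy ht)
  have hy1 : x (i - 1) ∈ Icc (0 : ℝ) 1 := ⟨hx0, by linarith⟩
  have hy2 : x (i + 1) ∈ Icc (0 : ℝ) 1 := ⟨by linarith, hx3⟩
  set p := x i - x (i - 1) with hp
  set q := x (i + 1) - x i with hq
  have hp0 : 0 < p := by linarith
  have hq0 : 0 < q := by linarith
  have t1 := abs_taylor_one_le (d0 _ hy1) (d1 _ hy1) (fun t ht => hM2 t (hsub _ hy1 ht))
  have t2 := abs_taylor_two_le (d0 _ hy1) (d1 _ hy1) (d2 _ hy1) (fun t ht => hM3 t (hsub _ hy1 ht))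
  have t3 := abs_taylor_two_le (d0 _ hy2) (d1 _ hy2) (d2 _ hy2) (fun t ht => hM3 t (hsub _ hy2 ht))
  have ep : x (i - 1) - x i = -p := by ring
  rw [ep, abs_neg, abs_of_pos hp0] at t1 t2
  rw [← hq, abs_of_pos hq0] at t3
  set r1 := v (x (i - 1)) - v (x i) - v1 (x i) * -p
  set r2 := v (x (i - 1)) - v (x i) - v1 (x i) * -p - v2 (x i) * (-p) ^ 2 / 2 with hr2
  set r3 := v (x (i + 1)) - v (x i) - v1 (x i) * q - v2 (x i) * q ^ 2 / 2 with hr3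
  have e1 : dMinus x (fun j => v (x j)) i - v1 (x i) = -(r1 / p) := by
    simp only [dMinus, ← hp, r1]
    field_simp
    ring
  -- The first-derivative terms cancel even when `p ≠ q`. The remainders are of order `q²` and `p²`
  -- after the inner division, so dividing by `p + q` leaves first order on an arbitrary mesh.
  have e2 : delta2 x (fun j => v (x j)) i - v2 (x i) = 2 * (r3 / q + r2 / p) / (p + q) := by
    have : x (i + 1) - x (i - 1) = p + q := by rw [hp, hq]; ring
    simp only [delta2, dPlus, dMinus, ← hp, ← hq, this, hr2, hr3]
    field_simp
    ring
  have b1 : |dMinus x (fun j => v (x j)) i - v1 (x i)| ≤ M * H := by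
    rw [e1, abs_neg, abs_div, abs_of_pos hp0, div_le_iff₀ hp0]
    refine t1.trans ?_
    have : M * p * p ≤ M * H * p := by gcongr
    linarith
  have b2 : |delta2 x (fun j => v (x j)) i - v2 (x i)| ≤ 4 * (M * H) := by
    rw [e2, abs_div, abs_of_pos (by linarith : 0 < p + q), div_le_iff₀ (by linarith), abs_mul]
    have u1 : |r3 / q| ≤ M * H * q := by
      rw [abs_div, abs_of_pos hq0, div_le_iff₀ hq0]
      refine t3.trans ?_
      have : M * q * q * q ≤ M * H * q * q := by gcongr
      linarith
    have u2 : |r2 / p| ≤ M * H * p := by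
      rw [abs_div, abs_of_pos hp0, div_le_iff₀ hp0]
      refine t2.trans ?_
      have : M * p * p * p ≤ M * H * p * p := by gcongr
      linarith
    have u3 := abs_add_le (r3 / q) (r2 / p)
    have u4 : 0 ≤ M * H * (p + q) := by
      have : 0 ≤ H := by linarith
      positivity
    rw [abs_of_pos (by norm_num : (0 : ℝ) < 2)]
    nlinarith
  have e3 : diffOp a b ε μ v (x i) - upwindOp a b ε μ x (fun j => v (x j)) i
      = ε * (delta2 x (fun j => v (x j)) i - v2 (x i))
        - μ * a (x i) * (dMinus x (fun j => v (x j)) i - v1 (x i)) := by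
    simp only [diffOp, upwindOp]
    ring
  rw [e3]
  refine (abs_sub _ _).trans ?_
  rw [abs_mul, abs_mul, abs_mul, abs_of_pos hε, abs_of_nonneg hμ]
  have hH : 0 ≤ H := by linarith
  have c1 : ε * |delta2 x (fun j => v (x j)) i - v2 (x i)| ≤ ε * (4 * (M * H)) := by gcongr
  have c2 : μ * |a (x i)| * |dMinus x (fun j => v (x j)) i - v1 (x i)| ≤ μ * A * (M * H) := by
    gcongr
  have c3 : 0 ≤ ε * (M * H) * A := by positivity
  have c4 : 0 ≤ μ * (M * H) := by positivity
  nlinarith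

/-! ### Geometry of the piecewise uniform mesh with `4 n` intervals -/

section Mesh

variable {sL sR : ℝ} {n : ℕ}

theorem meshPoint_of_le (hn : 0 < n) {i : ℕ} (hi : i ≤ n) :
    meshPoint sL sR (4 * n) i = i * (sL / n) := by
  have : (0 : ℝ) < n := by exact_mod_cast hn
  rw [meshPoint, if_pos (by omega)]
  push_cast
  field_simp

/-- Neighbouring branches agree at `i = n` and `i = 3 n`, so each formula holds on a closed range of
indices; this makes all step lengths direct differences of one formula. -/
theorem meshPoint_mid (hn : 0 < n) {i : ℕ} (hi : n ≤ i) (hi' : i ≤ 3 * n) :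
    meshPoint sL sR (4 * n) i = sL + ((i : ℝ) - n) * ((1 - sL - sR) / (2 * n)) := by
  have : (0 : ℝ) < n := by exact_mod_cast hn
  rcases hi.eq_or_lt with h | h
  · rw [meshPoint_of_le hn h.ge, ← h]
    field_simp
    ring
  · rw [meshPoint, if_neg (by omega), if_pos (by omega)]
    push_cast
    field_simp
    ring

theorem meshPoint_right (hn : 0 < n) {i : ℕ} (hi : 3 * n ≤ i) :
    meshPoint sL sR (4 * n) i = 1 - (4 * (n : ℝ) - i) * (sR / n) := by
  have : (0 : ℝ) < n := by exact_mod_cast hn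
  rcases hi.eq_or_lt with h | h
  · rw [meshPoint_mid hn (by omega) h.ge, ← h]
    push_cast
    field_simp
    ring
  · rw [meshPoint, if_neg (by omega), if_neg (by omega)]
    push_cast
    field_simp

theorem meshPoint_succ_sub_left (hn : 0 < n) {i : ℕ} (hi : i < n) :
    meshPoint sL sR (4 * n) (i + 1) - meshPoint sL sR (4 * n) i = sL / n := by
  rw [meshPoint_of_le hn (by omega), meshPoint_of_le hn (by omega)]
  push_cast
  ring

theorem meshPoint_succ_sub_mid (hn : 0 < n) {i : ℕ} (hi : n ≤ i) (hi' : i < 3 * n) :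
    meshPoint sL sR (4 * n) (i + 1) - meshPoint sL sR (4 * n) i = (1 - sL - sR) / (2 * n) := by
  rw [meshPoint_mid hn (by omega) (by omega), meshPoint_mid hn (by omega) (by omega)]
  push_cast
  ring

theorem meshPoint_succ_sub_right (hn : 0 < n) {i : ℕ} (hi : 3 * n ≤ i) :
    meshPoint sL sR (4 * n) (i + 1) - meshPoint sL sR (4 * n) i = sR / n := by
  rw [meshPoint_right hn (by omega), meshPoint_right hn (by omega)]
  push_cast
  ring

/-- The right branch continues past `i = 4 n` with the same step, so the mesh is strictly increasing
on all of `ℕ` and no index bound is carried along. -/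
theorem meshPoint_lt_succ (hn : 0 < n) (hL : 0 < sL) (hR : 0 < sR) (hLR : sL + sR < 1) {i : ℕ} :
    meshPoint sL sR (4 * n) i < meshPoint sL sR (4 * n) (i + 1) := by
  have hn' : (0 : ℝ) < n := by exact_mod_cast hn
  rw [← sub_pos]
  rcases lt_or_ge i n with h | h
  · rw [meshPoint_succ_sub_left hn h]; positivity
  rcases lt_or_ge i (3 * n) with h2 | h2
  · rw [meshPoint_succ_sub_mid hn h h2]
    exact div_pos (by linarith) (by positivity)
  · rw [meshPoint_succ_sub_right hn h2]; positivity

theorem meshPoint_strictMono (hn : 0 < n) (hL : 0 < sL) (hR : 0 < sR) (hLR : sL + sR < 1) :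
    StrictMono (meshPoint sL sR (4 * n)) :=
  strictMono_nat_of_lt_succ fun _ => meshPoint_lt_succ hn hL hR hLR

theorem meshPoint_zero (hn : 0 < n) : meshPoint sL sR (4 * n) 0 = 0 := by
  rw [meshPoint_of_le hn (by omega)]; simp

theorem meshPoint_last (hn : 0 < n) : meshPoint sL sR (4 * n) (4 * n) = 1 := by
  rw [meshPoint_right hn (by omega)]; push_cast; ring

theorem meshPoint_succ_sub_le (hn : 0 < n) (hL : 0 < sL) (hR : 0 < sR) (hL' : sL < 1 / 4)
    (hR' : sR < 1 / 4) {i : ℕ} :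
    meshPoint sL sR (4 * n) (i + 1) - meshPoint sL sR (4 * n) i ≤ 1 / (2 * n) := by
  have hn' : (0 : ℝ) < n := by exact_mod_cast hn
  rcases lt_or_ge i n with h | h
  · rw [meshPoint_succ_sub_left hn h, div_le_div_iff₀ hn' (by positivity)]
    nlinarith
  rcases lt_or_ge i (3 * n) with h2 | h2
  · rw [meshPoint_succ_sub_mid hn h h2]
    gcongr
    linarith
  · rw [meshPoint_succ_sub_right hn h2, div_le_div_iff₀ hn' (by positivity)]
    nlinarith

end Mesh

/-! ### Difference quotients on uniform pieces, and backward damping -/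

/-- Differences of a mesh function on a uniform part of the mesh that is at least as long as the
layer width `s`. -/
theorem abs_dMinus_le_of_uniform {a b : ℝ → ℝ} {ε μ s c κ A B E h : ℝ} {x e : ℕ → ℝ} {p n : ℕ}
    (hε : 0 < ε) (hμ : 0 ≤ μ) (hs : 0 < s) (hs2 : s ^ 2 ≤ ε) (hκ : 0 ≤ κ) (hμs : μ * s ≤ κ * ε)
    (hc : 0 < c) (hcn : c * s ≤ n * h) (hh : 0 < h) (hA0 : 0 ≤ A) (hB0 : 0 ≤ B) (hE0 : 0 ≤ E)
    (hA : ∀ j, p < j → j < p + n → |a (x j)| ≤ A) (hB : ∀ j, p < j → j < p + n → |b (x j)| ≤ B)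
    (he : ∀ j, p ≤ j → j ≤ p + n → |e j| ≤ E)
    (hτ : ∀ j, p < j → j < p + n → |upwindOp a b ε μ x e j| ≤ E)
    (hstep : ∀ j, p ≤ j → j < p + n → x (j + 1) - x j = h) :
    ∀ j, p < j → j ≤ p + n → |dMinus x e j| ≤
      8 * (1 / min c (1 / (4 * (κ * A + 1))) + (B + 1) * min c (1 / (4 * (κ * A + 1)))) * (E / s) := by
  -- The Landau window has length `δ s`: the bound `c` keeps it inside the piece, and the second
  -- bound makes the convective growth rate `μ A / ε` times the window at most `1/4`.
  set δ := min c (1 / (4 * (κ * A + 1))) with hδ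
  have hκA : 0 ≤ κ * A := by positivity
  have hδ0 : 0 < δ := lt_min hc (by positivity)
  have hδ2 : κ * A * δ ≤ 1 / 4 := by
    have h1 : δ ≤ 1 / (4 * (κ * A + 1)) := min_le_right _ _
    rw [le_div_iff₀ (by positivity)] at h1
    nlinarith
  have hstep' : ∀ j, p < j → j ≤ p + n → x j - x (j - 1) = h := by
    intro j h1 h2
    obtain ⟨k, rfl⟩ : ∃ k, j = k + 1 := ⟨j - 1, by omega⟩
    exact hstep k (by omega) (by omega)
  intro j h1 h2
  have hwδ : δ * s ≤ n * h := (mul_le_mul_of_nonneg_right (min_le_left _ _) hs.le).trans hcn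
  have key := abs_le_of_bounded_increments (d := dMinus x e) (e := e) (p := p) (n := n) (h := h)
    (w := δ * s) (P := μ * A / ε) (G := (B + 1) * E / ε) (E := E) hh (by positivity) hwδ
    (by positivity) (by positivity) ?_ he ?_ ?_ j h1 h2
  · refine key.trans ?_
    have h3 : E / (δ * s) = 1 / δ * (E / s) := by field_simp
    have h4 : (B + 1) * E / ε * (δ * s) ≤ (B + 1) * δ * (E / s) := by
      -- This is where `s² ≤ ε` makes the reaction and residual terms no larger than the main term
      -- `E / s`.
      have : s / ε ≤ 1 / s := by
        rw [div_le_div_iff₀ hε hs]; nlinarith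
      calc (B + 1) * E / ε * (δ * s) = (B + 1) * E * δ * (s / ε) := by ring
        _ ≤ (B + 1) * E * δ * (1 / s) := by gcongr
        _ = _ := by ring
    rw [h3]
    linarith
  · calc μ * A / ε * (δ * s) = (μ * s) * A * δ / ε := by ring
      _ ≤ (κ * ε) * A * δ / ε := by gcongr
      _ = κ * A * δ := by field_simp
      _ ≤ 1 / 4 := hδ2
  · intro j h1 h2
    rw [dMinus, hstep' j h1 h2]
    field_simp
  · intro j h1 h2
    have e1 := hstep' j h1 h2.le
    have e2 := hstep j h1.le h2
    have e3 : x (j + 1) - x (j - 1) = 2 * h := by linarith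
    rw [dMinus_succ_sub hε.ne' (by rw [e3]; positivity), e3, abs_mul,
      abs_of_pos (by positivity : 0 < 2 * h / 2 / ε)]
    have t1 : |μ * a (x j) * dMinus x e j + b (x j) * e j - upwindOp a b ε μ x e j|
        ≤ μ * A * |dMinus x e j| + B * E + E := by
      refine (abs_sub _ _).trans (add_le_add ((abs_add_le _ _).trans (add_le_add ?_ ?_)) (hτ j h1 h2))
      · rw [abs_mul, abs_mul, abs_of_nonneg hμ]
        have := hA j h1 h2
        gcongr
      · rw [abs_mul]
        have := hB j h1 h2
        have := he j h1.le h2.le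
        gcongr
    calc 2 * h / 2 / ε * |μ * a (x j) * dMinus x e j + b (x j) * e j - upwindOp a b ε μ x e j|
        ≤ 2 * h / 2 / ε * (μ * A * |dMinus x e j| + B * E + E) := by gcongr
      _ = h * (μ * A / ε * |dMinus x e j| + (B + 1) * E / ε) := by field_simp; ring

/-- Backward stability of the difference recursion. -/
theorem abs_dMinus_sub_mul_le {a b : ℝ → ℝ} {ε μ α Y : ℝ} {x e : ℕ → ℝ} {i : ℕ} (hε : 0 < ε)
    (hμ : 0 ≤ μ) (hα : 0 < α) (ha : α ≤ a (x i)) (hx : x (i - 1) < x (i + 1))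
    (hY : |b (x i) * e i - upwindOp a b ε μ x e i| ≤ μ * α * Y) :
    (|dMinus x e i| - Y) * (1 + μ * α * ((x (i + 1) - x (i - 1)) / 2) / ε)
      ≤ |dMinus x e (i + 1)| - Y := by
  have h1 := dMinus_succ_sub (a := a) (b := b) (μ := μ) (e := e) hε.ne'
    (by linarith : x (i + 1) - x (i - 1) ≠ 0)
  set k := (x (i + 1) - x (i - 1)) / 2 with hk
  have hk0 : 0 < k := by rw [hk]; linarith
  set d := dMinus x e i
  set d' := dMinus x e (i + 1)
  set g := b (x i) * e i - upwindOp a b ε μ x e i with hg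
  -- Solved for the left difference, the recursion divides by a factor at least `1`: convection
  -- damps errors travelling from right to left. The level `Y` absorbs the source term exactly.
  have h2 : d * (1 + μ * a (x i) * k / ε) = d' - k / ε * g := by
    rw [hg]
    linear_combination -h1
  have ha0 : 0 ≤ a (x i) := hα.le.trans ha
  have h3 : |d| * (1 + μ * a (x i) * k / ε) ≤ |d'| + k / ε * (μ * α * Y) := by
    have h4 : 0 ≤ 1 + μ * a (x i) * k / ε := by positivity
    calc |d| * (1 + μ * a (x i) * k / ε) = |d * (1 + μ * a (x i) * k / ε)| := by
          rw [abs_mul, abs_of_nonneg h4]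
      _ ≤ |d'| + |k / ε * g| := by rw [h2]; exact abs_sub _ _
      _ = |d'| + k / ε * |g| := by rw [abs_mul, abs_of_pos (by positivity : 0 < k / ε)]
      _ ≤ _ := by gcongr
  have h5 : |d| * (1 + μ * α * k / ε) ≤ |d| * (1 + μ * a (x i) * k / ε) := by gcongr
  have h6 : k / ε * (μ * α * Y) = μ * α * k / ε * Y := by ring
  linarith

/-- The mesh in the right layer resolves a decay by a factor of `N`. -/
theorem le_one_add_log_pow {n : ℕ} (hn : 0 < n) :
    (4 * n : ℝ) / 7 ≤ (1 + 4 * Real.log (4 * n) / n) ^ (n - 1) := by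
  have hn' : (0 : ℝ) < n := by exact_mod_cast hn
  have hn1 : (1 : ℝ) ≤ n := by exact_mod_cast hn
  set t := 4 * Real.log (4 * n) / n with ht
  have hlog : 0 ≤ Real.log (4 * n) := Real.log_nonneg (by linarith)
  have ht0 : 0 ≤ t := by positivity
  -- From `log y ≤ y - 1` at `y = 4n/e` one gets `log (4n) ≤ 4n/e ≤ 3n/2`.
  have ht6 : t ≤ 6 := by
    rw [ht, div_le_iff₀ hn']
    have h1 := Real.log_le_sub_one_of_pos (x := 4 * n / Real.exp 1) (by positivity)
    rw [Real.log_div (by positivity) (by positivity), Real.log_exp] at h1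
    have h2 : 4 * n / Real.exp 1 ≤ 3 / 2 * n := by
      rw [div_le_iff₀ (by positivity)]
      have := Real.exp_one_gt_d9
      nlinarith
    linarith
  have h1 : (4 * n : ℝ) ≤ (1 + t) ^ n := by
    have h2 := Real.le_log_one_add_of_nonneg ht0
    -- With `t + 2 ≤ 8`, `log (1 + t) ≥ t/4`, and the factor `4` of the right transition parameter
    -- gives exactly `(1 + t) ^ n ≥ 4 n`. Giving up one factor `1 + t ≤ 7` produces the exponent `n
    -- - 1`.
    have h3 : t / 4 ≤ 2 * t / (t + 2) := by
      rw [div_le_div_iff₀ (by norm_num) (by linarith)]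
      nlinarith
    have h4 : Real.log (4 * n) ≤ n * Real.log (1 + t) := by
      calc Real.log (4 * n) = n * (t / 4) := by rw [ht]; field_simp
        _ ≤ n * Real.log (1 + t) := by gcongr; linarith
    rw [← Real.log_pow] at h4
    exact (Real.log_le_log_iff (by positivity) (by positivity)).1 h4
  rw [div_le_iff₀ (by norm_num)]
  refine h1.trans ?_
  obtain ⟨m, rfl⟩ : ∃ m, n = m + 1 := ⟨n - 1, by omega⟩
  rw [pow_succ, Nat.add_sub_cancel]
  gcongr
  linarith

/-! ### Layer width, decay rates and the two regimes -/

section Parameters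

variable {α γ ε μ : ℝ}

/-- The width `√(ε / θ)` of the right layer. -/
noncomputable def layerWidth (α γ ε μ : ℝ) : ℝ := Real.sqrt (ε / theta α γ ε μ)

theorem one_le_theta : 1 ≤ theta α γ ε μ := le_max_left _ _

theorem layerWidth_pos (hε : 0 < ε) : 0 < layerWidth α γ ε μ :=
  Real.sqrt_pos.2 (div_pos hε (one_pos.trans_le one_le_theta))

theorem layerWidth_sq (hε : 0 < ε) : layerWidth α γ ε μ ^ 2 = ε / theta α γ ε μ :=
  Real.sq_sqrt (div_nonneg hε.le (zero_le_one.trans one_le_theta))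

theorem layerWidth_sq_le (hε : 0 < ε) : layerWidth α γ ε μ ^ 2 ≤ ε := by
  rw [layerWidth_sq hε]
  exact div_le_self hε.le one_le_theta

theorem layerWidth_le_one (hε : 0 < ε) (hε1 : ε ≤ 1) : layerWidth α γ ε μ ≤ 1 := by
  have := (layerWidth_sq_le (α := α) (γ := γ) (μ := μ) hε).trans hε1
  exact (sq_le_one_iff₀ (layerWidth_pos hε).le).1 this

/-- The lower bound `α μ² / (γ ε)` for `θ` is what keeps the Péclet number `μ s / ε` of one layer
width bounded. -/
theorem mul_layerWidth_le (hα : 0 < α) (hγ : 0 < γ) (hε : 0 < ε) :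
    μ * layerWidth α γ ε μ ≤ Real.sqrt (γ / α) * ε := by
  refine abs_le_of_sq_le_sq' ?_ (by positivity) |>.2
  rw [mul_pow, mul_pow, layerWidth_sq hε, Real.sq_sqrt (by positivity)]
  have hθ : α * μ ^ 2 / (γ * ε) ≤ theta α γ ε μ := le_max_right _ _
  have hθ0 : 0 < theta α γ ε μ := one_pos.trans_le one_le_theta
  rw [div_le_iff₀ (by positivity)] at hθ
  rw [← mul_div_assoc, div_le_iff₀ hθ0, div_mul_eq_mul_div, div_mul_eq_mul_div, le_div_iff₀ hα]
  nlinarith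

/-- The two branches of the maximum defining `θ`: dominant diffusion, with `s = √ε`, and dominant
convection, with `s` proportional to `ε/μ`. -/
theorem layerWidth_cases (hα : 0 < α) (hγ : 0 < γ) (hε : 0 < ε) :
    (theta α γ ε μ = 1 ∧ layerWidth α γ ε μ ^ 2 = ε) ∨
    (γ * ε ≤ α * μ ^ 2 ∧ α * μ ^ 2 * layerWidth α γ ε μ ^ 2 = γ * ε ^ 2) := by
  rcases le_total 1 (α * μ ^ 2 / (γ * ε)) with h | h
  · right
    have hθ : theta α γ ε μ = α * μ ^ 2 / (γ * ε) := max_eq_right h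
    have h1 : γ * ε ≤ α * μ ^ 2 := by rwa [one_le_div (by positivity)] at h
    refine ⟨h1, ?_⟩
    have : 0 < α * μ ^ 2 := lt_of_lt_of_le (by positivity) h1
    have hμ : μ ≠ 0 := by rintro rfl; simp at this
    rw [layerWidth_sq hε, hθ]
    field_simp
  · left
    have hθ : theta α γ ε μ = 1 := max_eq_left h
    rw [layerWidth_sq hε, hθ, div_one]
    exact ⟨rfl, rfl⟩

theorem rhoR_eq (hα : 0 < α) (hγ : 0 < γ) (hε : 0 < ε) :
    rhoR α γ ε μ = max 1 (Real.sqrt (γ * α) / layerWidth α γ ε μ) := by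
  have hθ0 : 0 < theta α γ ε μ := one_pos.trans_le one_le_theta
  rw [rhoR, layerWidth, ← Real.sqrt_div (by positivity)]
  congr 2
  field_simp

theorem rhoR_le (hα : 0 < α) (hγ : 0 < γ) (hε : 0 < ε) (hε1 : ε ≤ 1) :
    rhoR α γ ε μ ≤ (1 + Real.sqrt (γ * α)) / layerWidth α γ ε μ := by
  have hs := layerWidth_pos (α := α) (γ := γ) (μ := μ) hε
  have hs1 := layerWidth_le_one (α := α) (γ := γ) (μ := μ) hε hε1
  have h0 := Real.sqrt_nonneg (γ * α)
  rw [rhoR_eq hα hγ hε]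
  refine max_le ?_ ?_
  · rw [one_le_div hs]; linarith
  · gcongr; linarith

theorem rhoL_le (hα : 0 < α) (hγ : 0 < γ) (hε : 0 < ε) (hε1 : ε ≤ 1) (hθ : theta α γ ε μ = 1) :
    rhoL α γ ε μ ≤ (1 + Real.sqrt (γ * α)) / layerWidth α γ ε μ := by
  have hs := layerWidth_pos (α := α) (γ := γ) (μ := μ) hε
  have hs1 := layerWidth_le_one (α := α) (γ := γ) (μ := μ) hε hε1
  have h0 := Real.sqrt_nonneg (γ * α)
  refine max_le ?_ ?_
  · rw [one_le_div hs]; linarith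
  · have h1 : layerWidth α γ ε μ = Real.sqrt ε := by rw [layerWidth, hθ, div_one]
    rw [hθ, one_mul, Real.sqrt_div (by positivity), ← h1, ← mul_div_assoc]
    gcongr
    linarith

/-- An upper bound for a decay rate becomes a lower bound for the fitted mesh piece: it contains a
fixed fraction of the layer width, as the Landau argument requires. -/
theorem le_shishkin_parameter {ρ q k l s : ℝ} (hq : 0 ≤ q) (hk : 1 ≤ k) (hl : 1 ≤ l) (hs : 0 < s)
    (hs1 : s ≤ 1) (hρ0 : 0 < ρ) (hρ : ρ ≤ (1 + q) / s) :
    1 / (4 * (1 + q)) * s ≤ min (1 / 4) (k / ρ * l) := by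
  refine le_min ?_ ?_
  · have : 1 / (4 * (1 + q)) ≤ 1 / 4 := by
      apply one_div_le_one_div_of_le <;> linarith
    have h2 : 0 ≤ 1 / (4 * (1 + q)) := by positivity
    nlinarith
  · rw [le_div_iff₀ hs] at hρ
    calc 1 / (4 * (1 + q)) * s ≤ 1 / ρ := by
          rw [div_mul_eq_mul_div, div_le_div_iff₀ (by positivity) hρ0]
          nlinarith
      _ ≤ k / ρ := by gcongr
      _ = k / ρ * 1 := by ring
      _ ≤ k / ρ * l := by gcongr

end Parameters

/-! ### Damping under dominant convection and the bound on the whole mesh -/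

/-- In the convection-dominated case the boundary difference is damped at the coarse mesh. -/
theorem abs_dMinus_le_of_convection {a b : ℝ → ℝ} {ε μ α t Y Z : ℝ} {x e : ℕ → ℝ} {n : ℕ}
    (hn : 0 < n) (hε : 0 < ε) (hμ : 0 < μ) (hα : 0 < α) (hx : StrictMono x)
    (ha : ∀ i, 0 < i → i < 4 * n → α ≤ a (x i)) (hY0 : 0 ≤ Y) (hZ : 0 ≤ Z)
    (hY : ∀ i, 0 < i → i < 4 * n → |b (x i) * e i - upwindOp a b ε μ x e i| ≤ μ * α * Y)
    (hstep : ∀ i, 3 * n ≤ i → x (i + 1) - x i = t * ε / (μ * α))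
    (hmid : 1 / (4 * n) ≤ x (3 * n) - x (3 * n - 1))
    (ht : (4 * n : ℝ) / 7 ≤ (1 + t) ^ (n - 1))
    (hlast : |dMinus x e (4 * n)| ≤ Z * μ / ε) :
    ∀ i, 1 ≤ i → i ≤ 3 * n → |dMinus x e i| ≤ 14 * Z / α + Y := by
  have hn' : (0 : ℝ) < n := by exact_mod_cast hn
  have hxlt : ∀ i, 0 < i → x (i - 1) < x (i + 1) := fun i hi => hx (by omega)
  have ht0 : 0 < t := by
    have h1 := hx (Nat.lt_succ_self (3 * n))
    have h2 := hstep (3 * n) le_rfl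
    have h3 : 0 < t * ε / (μ * α) := by rw [← h2]; exact sub_pos.2 h1
    rw [div_pos_iff_of_pos_right (by positivity)] at h3
    exact (pos_iff_pos_of_mul_pos h3).2 hε
  have hrec := fun i (h1 : 0 < i) (h2 : i < 4 * n) =>
    abs_dMinus_sub_mul_le hε hμ.le hα (ha i h1 h2) (hxlt i h1) (hY i h1 h2)
  -- Only the `n - 1` nodes strictly inside the right piece have two fine neighbouring steps; each
  -- contributes the full factor `1 + t`.
  have hfine : ∀ k, k ≤ n - 1 →
      (|dMinus x e (4 * n - k)| - Y) * (1 + t) ^ k ≤ |dMinus x e (4 * n)| - Y := by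
    intro k
    induction k with
    | zero => intro _; simp
    | succ k ih =>
      intro hk
      have h1 := ih (by omega)
      have h2 := hrec (4 * n - (k + 1)) (by omega) (by omega)
      have h3 : 4 * n - (k + 1) + 1 = 4 * n - k := by omega
      have h4 : (x (4 * n - (k + 1) + 1) - x (4 * n - (k + 1) - 1)) / 2 = t * ε / (μ * α) := by
        have e1 := hstep (4 * n - (k + 1)) (by omega)
        have e2 := hstep (4 * n - (k + 1) - 1) (by omega)
        rw [show 4 * n - (k + 1) - 1 + 1 = 4 * n - (k + 1) by omega] at e2
        linarith
      have h5 : μ * α * (t * ε / (μ * α)) / ε = t := by field_simp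
      rw [h4, h5, h3] at h2
      refine le_trans ?_ h1
      rw [pow_succ', ← mul_assoc]
      gcongr
  -- At the transition node the mean step is at least `1/(8n)`. The resulting factor `μα/(8nε)`
  -- times the fine-mesh factor `4n/7` is `(α/14)(μ/ε)`, which cancels the `μ/ε` in the bound at the
  -- right end.
  have hU : |dMinus x e (3 * n)| - Y ≤ 14 * Z / α := by
    have h1 := hfine (n - 1) le_rfl
    have h2 := hrec (3 * n) (by omega) (by omega)
    have h3 : 4 * n - (n - 1) = 3 * n + 1 := by omega
    rw [h3] at h1
    rcases le_or_gt (|dMinus x e (3 * n)| - Y) 0 with hneg | hpos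
    · exact hneg.trans (by positivity)
    set u := |dMinus x e (3 * n)| - Y
    have h4 : 1 / (8 * n) ≤ (x (3 * n + 1) - x (3 * n - 1)) / 2 := by
      have := hx (Nat.lt_succ_self (3 * n))
      have e1 : (1 : ℝ) / (8 * n) = 1 / (4 * n) / 2 := by field_simp; norm_num
      rw [e1]
      simp only [Nat.succ_eq_add_one] at this
      linarith
    have h5 : u * (μ * α * (1 / (8 * n)) / ε) ≤ |dMinus x e (3 * n + 1)| - Y := by
      refine le_trans ?_ h2
      have : μ * α * (1 / (8 * n)) / ε ≤ μ * α * ((x (3 * n + 1) - x (3 * n - 1)) / 2) / ε := by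
        gcongr
      gcongr
      linarith
    have h6 : u * (μ * α * (1 / (8 * n)) / ε) * ((4 * n : ℝ) / 7) ≤ Z * μ / ε := by
      calc _ ≤ u * (μ * α * (1 / (8 * n)) / ε) * (1 + t) ^ (n - 1) := by gcongr
        _ ≤ (|dMinus x e (3 * n + 1)| - Y) * (1 + t) ^ (n - 1) := by gcongr
        _ ≤ _ := by linarith
    have h7 : u * (μ * α * (1 / (8 * n)) / ε) * ((4 * n : ℝ) / 7) = (u * α / 14) * (μ / ε) := by
      field_simp
      ring
    rw [h7, mul_div_assoc Z] at h6
    have h8 := le_of_mul_le_mul_right h6 (by positivity)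
    rw [le_div_iff₀ hα]
    linarith
  -- To the left only monotonicity is used: an excess over `Y` cannot grow from right to left.
  have hcoarse : ∀ k, k < 3 * n → |dMinus x e (3 * n - k)| - Y ≤ 14 * Z / α := by
    intro k
    induction k with
    | zero => intro _; simpa using hU
    | succ k ih =>
      intro hk
      have h1 := ih (by omega)
      have h2 := hrec (3 * n - (k + 1)) (by omega) (by omega)
      rw [show 3 * n - (k + 1) + 1 = 3 * n - k by omega] at h2
      rcases le_or_gt (|dMinus x e (3 * n - (k + 1))| - Y) 0 with hneg | hpos
      · exact hneg.trans (by positivity)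
      refine le_trans ?_ (h2.trans h1)
      apply le_mul_of_one_le_right hpos.le
      have := hxlt (3 * n - (k + 1)) (by omega)
      rw [show 3 * n - (k + 1) + 1 = 3 * n - k by omega] at this
      have h9 : 0 ≤ (x (3 * n - k) - x (3 * n - (k + 1) - 1)) / 2 := by linarith
      have : 0 ≤ μ * α * ((x (3 * n - k) - x (3 * n - (k + 1) - 1)) / 2) / ε := by positivity
      linarith
  intro i h1 h2
  have := hcoarse (3 * n - i) (by omega)
  rw [show 3 * n - (3 * n - i) = i by omega] at this
  linarith

theorem sigmaR_pos {α γ ε μ : ℝ} {n : ℕ} (hn : 0 < n) : 0 < sigmaR α γ ε μ (4 * n) := by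
  have : (1 : ℝ) ≤ n := by exact_mod_cast hn
  have h1 : 0 < rhoR α γ ε μ := one_pos.trans_le (le_max_left _ _)
  have h2 : 0 < Real.log ((4 * n : ℕ) : ℝ) := Real.log_pos (by push_cast; linarith)
  exact lt_min (by norm_num) (by positivity)

theorem sigmaL_pos {α γ ε μ : ℝ} {n : ℕ} (hn : 0 < n) : 0 < sigmaL α γ ε μ (4 * n) := by
  have : (1 : ℝ) ≤ n := by exact_mod_cast hn
  have h1 : 0 < rhoL α γ ε μ := one_pos.trans_le (le_max_left _ _)
  have h2 : 0 < Real.log ((4 * n : ℕ) : ℝ) := Real.log_pos (by push_cast; linarith)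
  exact lt_min (by norm_num) (by positivity)

theorem one_le_log_four_mul {n : ℕ} (hn : 0 < n) : 1 ≤ Real.log ((4 * n : ℕ) : ℝ) := by
  have : (1 : ℝ) ≤ n := by exact_mod_cast hn
  rw [Real.le_log_iff_exp_le (by push_cast; linarith)]
  have := Real.exp_one_lt_d9
  push_cast
  linarith

/-- Since `ε` is at most a multiple of `μ`, data of size `ε + μ` can be absorbed in the source level
`μ α Y` of the backward recursion. -/
theorem convection_params {α γ ε μ : ℝ} (hα : 0 < α) (hγ : 0 < γ) (hε : 0 < ε)
    (hμ : 0 ≤ μ) (hμ1 : μ ≤ 1) (hcv : γ * ε ≤ α * μ ^ 2)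
    (hsε : α * μ ^ 2 * layerWidth α γ ε μ ^ 2 = γ * ε ^ 2) :
    0 < μ ∧ ε + μ ≤ (α / γ + 1) * μ ∧ layerWidth α γ ε μ * μ = Real.sqrt (γ / α) * ε := by
  refine ⟨?_, ?_, ?_⟩
  · rcases hμ.eq_or_lt with h | h
    · rw [← h] at hcv
      have : 0 < γ * ε := by positivity
      norm_num at hcv
      linarith
    · exact h
  · have : ε ≤ α / γ * μ := by
      rw [div_mul_eq_mul_div, le_div_iff₀ hγ]
      nlinarith [mul_le_mul_of_nonneg_left hμ1 (mul_nonneg hα.le hμ)]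
    linarith
  · have hs0 := layerWidth_pos (α := α) (γ := γ) (μ := μ) hε
    have h3 : (layerWidth α γ ε μ * μ) ^ 2 = (Real.sqrt (γ / α) * ε) ^ 2 := by
      rw [mul_pow, mul_pow, Real.sq_sqrt (by positivity), div_mul_eq_mul_div, eq_div_iff hα.ne']
      linarith
    exact (pow_left_inj₀ (by positivity) (by positivity) two_ne_zero).1 h3

/-- In this regime `√(γα)/s = αμ/ε`. The assumption that the transition parameter is below `1/4`
rules out both outer cut-offs, because rate `1` would give the value `1/4`. The fine step is then `t
ε/(μα)` with `t = 4 log (4n) / n`. -/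
theorem sigmaR_eq_of_convection {α γ ε μ : ℝ} {n : ℕ} (hα : 0 < α) (hγ : 0 < γ) (hε : 0 < ε)
    (hμ : 0 < μ) (hsμ : layerWidth α γ ε μ * μ = Real.sqrt (γ / α) * ε)
    (hσ : sigmaR α γ ε μ (4 * n) < 1 / 4) :
    sigmaR α γ ε μ (4 * n) = 4 * Real.log (4 * n) * ε / (μ * α) := by
  rcases Nat.eq_zero_or_pos n with rfl | hn
  · simp [sigmaR]
  have hlog := one_le_log_four_mul hn
  have hs0 := layerWidth_pos (α := α) (γ := γ) (μ := μ) hε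
  have hq1 : Real.sqrt (γ * α) / layerWidth α γ ε μ = α * μ / ε := by
    rw [div_eq_div_iff hs0.ne' hε.ne']
    have : Real.sqrt (γ * α) = α * Real.sqrt (γ / α) := by
      rw [show γ * α = α ^ 2 * (γ / α) by field_simp, Real.sqrt_mul (by positivity),
        Real.sqrt_sq hα.le]
    rw [this]
    linear_combination -α * hsμ
  have hρ : rhoR α γ ε μ = α * μ / ε := by
    rw [rhoR_eq hα hγ hε, hq1]
    refine max_eq_right ?_
    by_contra hcon
    push Not at hcon
    have h4 : rhoR α γ ε μ = 1 := by
      rw [rhoR_eq hα hγ hε, hq1]; exact max_eq_left hcon.le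
    have h5 : sigmaR α γ ε μ (4 * n) = 1 / 4 := by
      rw [sigmaR, h4]
      refine min_eq_left ?_
      linarith
    linarith
  have h3 : sigmaR α γ ε μ (4 * n) = 4 / rhoR α γ ε μ * Real.log ((4 * n : ℕ) : ℝ) := by
    rw [sigmaR] at hσ ⊢
    rcases min_lt_iff.1 hσ with h | h
    · exact absurd h (lt_irrefl _)
    · exact min_eq_right h.le
  rw [h3, hρ]
  push_cast
  field_simp

set_option maxHeartbeats 800000 in
/-- Discrete derivative bounds for mesh functions with small residual on the Shishkin mesh. -/
theorem exists_dMinus_bound {α γ : ℝ} (hα : 0 < α) (hγ : 0 < γ) {A B : ℝ} (hA0 : 0 ≤ A)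
    (hB0 : 0 ≤ B) :
    ∃ C : ℝ, 0 ≤ C ∧ ∀ (a b : ℝ → ℝ) (ε μ E : ℝ) (n : ℕ) (x e : ℕ → ℝ), 0 < ε → ε ≤ 1 → 0 ≤ μ →
      μ ≤ 1 → 0 < n → 0 ≤ E → x = shishkin α γ ε μ (4 * n) →
      sigmaR α γ ε μ (4 * n) ≤ sigmaL α γ ε μ (4 * n) → sigmaL α γ ε μ (4 * n) < 1 / 4 →
      (∀ i, 0 < i → i < 4 * n → α ≤ a (x i)) → (∀ i, 0 < i → i < 4 * n → |a (x i)| ≤ A) →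
      (∀ i, 0 < i → i < 4 * n → |b (x i)| ≤ B) →
      (∀ i, i ≤ 4 * n → |e i| ≤ E * (ε + μ)) →
      (∀ i, 0 < i → i < 4 * n → |upwindOp a b ε μ x e i| ≤ E * (ε + μ)) →
      ∀ i, 1 ≤ i → i ≤ 4 * n →
        (i ≤ 3 * n → |dMinus x e i| ≤ C * E) ∧ layerWidth α γ ε μ * |dMinus x e i| ≤ C * E := by
  set q := Real.sqrt (γ * α) with hq
  set κ := Real.sqrt (γ / α) with hκ
  have hq0 : 0 ≤ q := Real.sqrt_nonneg _
  have hκ0 : 0 < κ := Real.sqrt_pos.2 (by positivity)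
  set c := 1 / (4 * (1 + q)) with hc
  have hc0 : 0 < c := by positivity
  set δ := min c (1 / (4 * (κ * A + 1))) with hδ
  have hκA : 0 ≤ κ * A := by positivity
  have hδ0 : 0 < δ := lt_min hc0 (by positivity)
  set Λ := 8 * (1 / δ + (B + 1) * δ) with hΛ
  have hΛ0 : 0 < Λ := by positivity
  set C1 := Λ * (1 + κ) with hC1
  set C2 := 14 * (2 * Λ / κ) / α + (B + 1) * (α / γ + 1) / α with hC2
  have hC10 : 0 ≤ C1 := by positivity
  have hC20 : 0 ≤ C2 := by positivity
  clear_value C1 C2 Λ δ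
  refine ⟨2 * Λ + C1 + C2, by positivity, ?_⟩
  intro a b ε μ E n x e hε hε1 hμ hμ1 hn hE hxdef hRL hL ha hA hB he hτ
  have hn' : (0 : ℝ) < n := by exact_mod_cast hn
  set s := layerWidth α γ ε μ with hs
  set sL := sigmaL α γ ε μ (4 * n) with hsL
  set sR := sigmaR α γ ε μ (4 * n) with hsR
  have hs0 : 0 < s := layerWidth_pos hε
  have hs1 : s ≤ 1 := layerWidth_le_one hε hε1
  have hs2 : s ^ 2 ≤ ε := layerWidth_sq_le hε
  have hμs : μ * s ≤ κ * ε := mul_layerWidth_le hα hγ hε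
  have hlog := one_le_log_four_mul hn
  have hsR0 : 0 < sR := sigmaR_pos hn
  have hsL0 : 0 < sL := sigmaL_pos hn
  have hxm : x = meshPoint sL sR (4 * n) := hxdef
  have hmono : StrictMono x := by
    rw [hxm]; exact meshPoint_strictMono hn hsL0 hsR0 (by linarith)
  have hcR : c * s ≤ sR :=
    le_shishkin_parameter hq0 (by norm_num) hlog hs0 hs1 (one_pos.trans_le (le_max_left _ _))
      (rhoR_le hα hγ hε hε1)
  have hE' : 0 ≤ E * (ε + μ) := by positivity
  -- The Landau estimate for any uniform piece long enough; it is applied to the right piece always,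
  -- and to the other two when `θ = 1`.
  have piece : ∀ (p m : ℕ) (h : ℝ), p + m ≤ 4 * n → 0 < h → c * s ≤ m * h →
      (∀ j, p ≤ j → j < p + m → x (j + 1) - x j = h) →
      ∀ j, p < j → j ≤ p + m → |dMinus x e j| ≤ Λ * (E * (ε + μ) / s) := by
    intro p m h hpm hh hcm hst
    rw [hΛ, hδ]
    exact abs_dMinus_le_of_uniform hε hμ hs0 hs2 hκ0.le hμs hc0 hcm hh hA0 hB0 hE'
      (fun j h1 h2 => hA j (by omega) (by omega)) (fun j h1 h2 => hB j (by omega) (by omega))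
      (fun j h1 h2 => he j (by omega)) (fun j h1 h2 => hτ j (by omega) (by omega)) hst
  have hstepR : ∀ j, 3 * n ≤ j → x (j + 1) - x j = sR / n := by
    intro j hj
    rw [hxm]; exact meshPoint_succ_sub_right hn hj
  have hright : ∀ j, 3 * n < j → j ≤ 4 * n → |dMinus x e j| ≤ Λ * (E * (ε + μ) / s) := by
    intro j h1 h2
    refine piece (3 * n) n (sR / n) (by omega) (by positivity) ?_ (fun j h _ => hstepR j h) j h1
      (by omega)
    rw [mul_div_cancel₀ _ hn'.ne']
    exact hcR
  have hcoarse : ∀ i, 1 ≤ i → i ≤ 3 * n → |dMinus x e i| ≤ (C1 + C2) * E := by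
    intro i h1 h2
    rcases layerWidth_cases (μ := μ) hα hγ hε with ⟨hθ, hsε⟩ | ⟨hcv, hsε⟩
    · rw [← hs] at hsε
      have hcL : c * s ≤ sL :=
        le_shishkin_parameter hq0 (by norm_num) hlog hs0 hs1 (one_pos.trans_le (le_max_left _ _))
          (rhoL_le hα hγ hε hε1 hθ)
      have hM : Λ * (E * (ε + μ) / s) ≤ C1 * E := by
        -- With `s² = ε ≤ s` and `μ ≤ κ s` the loss `1/s` is compensated by the factor `ε + μ` of
        -- the data.
        have : (ε + μ) / s ≤ 1 + κ := by
          rw [div_le_iff₀ hs0]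
          have h3 : μ ≤ κ * s := by
            rw [← hsε] at hμs
            have : μ * s ≤ κ * s * s := by linarith
            exact le_of_mul_le_mul_right this hs0
          nlinarith
        calc Λ * (E * (ε + μ) / s) = Λ * E * ((ε + μ) / s) := by ring
          _ ≤ Λ * E * (1 + κ) := by gcongr
          _ = _ := by rw [hC1]; ring
      have hC2E : 0 ≤ C2 * E := by positivity
      have : |dMinus x e i| ≤ Λ * (E * (ε + μ) / s) := by
        rcases le_or_gt i n with h3 | h3
        · refine piece 0 n (sL / n) (by omega) (by positivity) ?_ (fun j _ h => ?_) i h1 (by omega)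
          · rw [mul_div_cancel₀ _ hn'.ne']
            exact hcL
          · rw [hxm]; exact meshPoint_succ_sub_left hn (by omega)
        · refine piece n (2 * n) ((1 - sL - sR) / (2 * n)) (by omega)
            (div_pos (by linarith) (by positivity)) ?_ (fun j h h' => ?_) i h3 (by omega)
          · push_cast
            rw [mul_div_cancel₀ _ (by positivity)]
            linarith
          · rw [hxm]; exact meshPoint_succ_sub_mid hn h (by omega)
      linarith
    · obtain ⟨hμ0, hεμ, hsμ⟩ := convection_params hα hγ hε hμ hμ1 hcv hsε
      have hsR' : sR = 4 * Real.log (4 * n) * ε / (μ * α) :=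
        sigmaR_eq_of_convection hα hγ hε hμ0 hsμ (by linarith)
      rw [← hs, ← hκ] at hsμ
      have hcoarse := abs_dMinus_le_of_convection (a := a) (b := b) (ε := ε) (μ := μ) (α := α)
        (t := 4 * Real.log (4 * n) / n) (Y := (B + 1) * (α / γ + 1) / α * E)
        (Z := 2 * Λ / κ * E) (x := x) (e := e)
        hn hε hμ0 hα hmono ha (by positivity) (by positivity) ?_ ?_ ?_ (le_one_add_log_pow hn) ?_
        i h1 h2
      · refine hcoarse.trans ?_
        have h3 : 0 ≤ C1 * E := by positivity
        have h4 : 14 * (2 * Λ / κ * E) / α + (B + 1) * (α / γ + 1) / α * E = C2 * E := by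
          rw [hC2]; ring
        linarith
      · intro j h3 h4
        refine (abs_sub _ _).trans ?_
        rw [abs_mul]
        calc |b (x j)| * |e j| + |upwindOp a b ε μ x e j|
            ≤ B * (E * (ε + μ)) + E * (ε + μ) := by
              have u1 := hB j h3 h4
              have u2 := he j h4.le
              have u3 := hτ j h3 h4
              gcongr
          _ = (B + 1) * E * (ε + μ) := by ring
          _ ≤ (B + 1) * E * ((α / γ + 1) * μ) := by gcongr
          _ = μ * α * ((B + 1) * (α / γ + 1) / α * E) := by field_simp
      · intro j hj
        rw [hstepR j hj, hsR']
        field_simp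
      · have h3 := meshPoint_succ_sub_mid (sL := sL) (sR := sR) hn (i := 3 * n - 1) (by omega)
          (by omega)
        rw [show 3 * n - 1 + 1 = 3 * n by omega, ← hxm] at h3
        rw [h3, div_le_div_iff₀ (by positivity) (by positivity)]
        nlinarith
      -- Starting value for the damping: the layer estimate at the last node, with `1/s` rewritten
      -- as `μ/(κ ε)` and `ε + μ ≤ 2`.
      · refine (hright (4 * n) (by omega) le_rfl).trans ?_
        have h3 : 2 * Λ / κ * E * μ / ε = Λ * (E * 2 / s) := by
          have : μ = κ * ε / s := by rw [← hsμ]; field_simp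
          rw [this]; field_simp
        rw [h3]
        gcongr
        linarith
  have hΛE : 0 ≤ 2 * Λ * E := by positivity
  have hCE : 0 ≤ (C1 + C2) * E := by positivity
  intro i h1 h2
  refine ⟨fun h3 => ?_, ?_⟩
  · have := hcoarse i h1 h3
    linarith
  · rcases le_or_gt i (3 * n) with h3 | h3
    · have := hcoarse i h1 h3
      have h4 : s * |dMinus x e i| ≤ 1 * |dMinus x e i| := by gcongr
      linarith
    · have h4 := hright i h3 h2
      calc s * |dMinus x e i| ≤ s * (Λ * (E * (ε + μ) / s)) := by gcongr
        _ = Λ * E * (ε + μ) * (s / s) := by ring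
        _ = Λ * E * (ε + μ) := by rw [div_self hs0.ne', mul_one]
        _ ≤ Λ * E * 2 := by gcongr; linarith
        _ ≤ _ := by linarith

/-! ### Error of the discrete regular component -/

theorem exists_abs_le_on_unit {g : ℝ → ℝ} (hg : ContinuousOn g (Icc 0 1)) :
    ∃ A : ℝ, 0 ≤ A ∧ ∀ t ∈ Icc (0 : ℝ) 1, |g t| ≤ A := by
  obtain ⟨A, hA⟩ := isCompact_Icc.exists_bound_of_continuousOn hg
  exact ⟨A, (norm_nonneg _).trans (hA 0 (by simp)), hA⟩

/-- Existence of the discrete regular component and bounds for its discrete derivative errors. -/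
theorem discrete_regular_component_error {a b : ℝ → ℝ} (f : ℝ → ℝ) {α γ : ℝ} (hα : 0 < α)
    (hγ : 0 < γ) (ha : ContinuousOn a (Icc 0 1)) (hb : ContinuousOn b (Icc 0 1))
    (haα : ∀ x ∈ Ioo (0 : ℝ) 1, α < a x) (hbγ : ∀ x ∈ Ioo (0 : ℝ) 1, γ * a x < b x) (K : ℝ) :
    ∃ C : ℝ, 0 ≤ C ∧ ∀ ε μ : ℝ, 0 < ε → ε ≤ 1 → 0 ≤ μ → μ ≤ 1 →
      ∀ v : ℝ → ℝ, IsRegularComponent a b f α γ ε μ K v → ∀ n : ℕ, 0 < n →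
        sigmaR α γ ε μ (4 * n) ≤ sigmaL α γ ε μ (4 * n) → sigmaL α γ ε μ (4 * n) < 1 / 4 →
        (∃ V : ℕ → ℝ, IsDiscreteRegularComponent a b f ε μ (4 * n) (shishkin α γ ε μ (4 * n)) v V) ∧
        ∀ V : ℕ → ℝ,
          IsDiscreteRegularComponent a b f ε μ (4 * n) (shishkin α γ ε μ (4 * n)) v V →
          ∀ i, 1 ≤ i → i ≤ 4 * n →
            (i ≤ 3 * n → |dMinus (shishkin α γ ε μ (4 * n))
              (fun j => V j - v (shishkin α γ ε μ (4 * n) j)) i| ≤ C * ((4 * n : ℕ) : ℝ)⁻¹) ∧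
            layerWidth α γ ε μ * |dMinus (shishkin α γ ε μ (4 * n))
              (fun j => V j - v (shishkin α γ ε μ (4 * n) j)) i| ≤ C * ((4 * n : ℕ) : ℝ)⁻¹ := by
  obtain ⟨A, hA0, hA⟩ := exists_abs_le_on_unit ha
  obtain ⟨B, hB0, hB⟩ := exists_abs_le_on_unit hb
  obtain ⟨C, hC0, hC⟩ := exists_dMinus_bound hα hγ hA0 hB0
  have hβ : 0 < γ * α := mul_pos hγ hα
  set M := 2 * |K| with hM
  refine ⟨2 * C * M * (4 + A) * (1 + 1 / (γ * α)), by positivity, ?_⟩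
  intro ε μ hε hε1 hμ hμ1 v hv n hn hRL hL
  have hn' : (0 : ℝ) < n := by exact_mod_cast hn
  have hs0 : 0 < layerWidth α γ ε μ := layerWidth_pos hε
  have hs1 : layerWidth α γ ε μ ≤ 1 := layerWidth_le_one hε hε1
  have hsR0 : 0 < sigmaR α γ ε μ (4 * n) := sigmaR_pos hn
  have hsL0 : 0 < sigmaL α γ ε μ (4 * n) := sigmaL_pos hn
  have hmono : StrictMono (shishkin α γ ε μ (4 * n)) :=
    meshPoint_strictMono hn hsL0 hsR0 (by linarith)
  have hx0 : shishkin α γ ε μ (4 * n) 0 = 0 := meshPoint_zero hn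
  have hxN : shishkin α γ ε μ (4 * n) (4 * n) = 1 := meshPoint_last hn
  have hgap : ∀ i, shishkin α γ ε μ (4 * n) (i + 1) - shishkin α γ ε μ (4 * n) i ≤ 1 / (2 * n) :=
    fun i => meshPoint_succ_sub_le hn hsL0 hsR0 hL (by linarith)
  generalize hx : shishkin α γ ε μ (4 * n) = x at hmono hx0 hxN hgap ⊢
  have hin : ∀ i, 0 < i → i < 4 * n → x i ∈ Ioo (0 : ℝ) 1 := fun i h1 h2 =>
    ⟨hx0 ▸ hmono h1, hxN ▸ hmono h2⟩
  have hstep : ∀ i < 4 * n, x i < x (i + 1) := fun i _ => hmono (Nat.lt_succ_self i)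
  have hax : ∀ i, 0 < i → i < 4 * n → α ≤ a (x i) := fun i h1 h2 => (haα _ (hin i h1 h2)).le
  have hbx : ∀ i, 0 < i → i < 4 * n → γ * α ≤ b (x i) := fun i h1 h2 => by
    have h3 := hax i h1 h2
    have h4 := hbγ _ (hin i h1 h2)
    nlinarith
  have hax0 : ∀ i, 0 < i → i < 4 * n → 0 ≤ a (x i) := fun i h1 h2 => hα.le.trans (hax i h1 h2)
  refine ⟨?_, ?_⟩
  · obtain ⟨V, h1, h2, h3⟩ := exists_upwind_solution hε hμ (by omega : 0 < 4 * n) hβ hstep hax0 hbx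
      (fun i => f (x i)) (v 0) (v 1)
    exact ⟨V, h1, h2, h3⟩
  intro V hV
  -- Consistency needs only the second and third derivatives. For `k ≤ 3` the exponent `3 - k` is
  -- nonnegative, so the layer width drops out of the bound.
  have hder : ∀ k : ℕ, k ≤ 3 → ∀ t ∈ Icc (0 : ℝ) 1, |iteratedDerivWithin k v (Icc 0 1) t| ≤ M := by
    intro k hk t ht
    refine (hv.bound k (by omega) t ht).trans ?_
    change K * (1 + layerWidth α γ ε μ ^ ((3 : ℤ) - (k : ℤ))) ≤ M
    rw [show (3 : ℤ) - k = ((3 - k : ℕ) : ℤ) by omega, zpow_natCast]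
    have h1 : layerWidth α γ ε μ ^ (3 - k) ≤ 1 := pow_le_one₀ hs0.le hs1
    have h2 : 0 ≤ layerWidth α γ ε μ ^ (3 - k) := by positivity
    have h3 := le_abs_self K
    have h4 := abs_nonneg K
    rw [hM]
    nlinarith
  set T := M * (1 / (2 * n)) * (4 + A) * (ε + μ) with hT
  have hT0 : 0 ≤ T := by positivity
  have hτ : ∀ i, 0 < i → i < 4 * n →
      |upwindOp a b ε μ x (fun j => V j - v (x j)) i| ≤ T := by
    intro i h1 h2
    have e1 : upwindOp a b ε μ x (fun j => V j - v (x j)) i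
        = diffOp a b ε μ v (x i) - upwindOp a b ε μ x (fun j => v (x j)) i := by
      rw [hv.eqn _ (hin i h1 h2), ← hV.eqn i h1 h2]
      unfold upwindOp delta2 dPlus dMinus
      ring
    rw [e1]
    have hg1 := hgap (i - 1)
    rw [show i - 1 + 1 = i by omega] at hg1
    exact abs_diffOp_sub_upwindOp_le hε hμ hv.contDiffOn (hA _ (Ioo_subset_Icc_self (hin i h1 h2)))
      (hx0 ▸ hmono.monotone (Nat.zero_le _)) (hmono (by omega)) (hmono (by omega))
      (hxN ▸ hmono.monotone (by omega)) hg1 (hgap i) (hder 2 (by norm_num)) (hder 3 le_rfl)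
  have he := upwind_abs_le (e := fun j => V j - v (x j)) hε hμ hβ hT0 hstep hax0 hbx
    (by simp [hV.left, hx0]) (by simp [hV.right, hxN]) hτ
  -- Chosen so that `E (ε + μ) = T + T/(γα)`, which dominates the residual bound and the
  -- maximum-principle bound together.
  set E := M * (1 / (2 * n)) * (4 + A) * (1 + 1 / (γ * α)) with hE
  have hE0 : 0 ≤ E := by positivity
  have hTE : E * (ε + μ) = T + T / (γ * α) := by rw [hE, hT]; ring
  have hTβ : 0 ≤ T / (γ * α) := by positivity
  have hfin : 2 * C * M * (4 + A) * (1 + 1 / (γ * α)) * ((4 * n : ℕ) : ℝ)⁻¹ = C * E := by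
    rw [hE]
    push_cast
    field_simp
    ring
  rw [hfin]
  refine hC a b ε μ E n x _ hε hε1 hμ hμ1 hn hE0 hx.symm hRL hL hax
    (fun i h1 h2 => hA _ (Ioo_subset_Icc_self (hin i h1 h2)))
    (fun i h1 h2 => hB _ (Ioo_subset_Icc_self (hin i h1 h2))) (fun i hi => ?_)
    (fun i h1 h2 => ?_)
  · exact (he i hi).trans (by linarith)
  · exact (hτ i h1 h2).trans (by linarith)

/-! ### Global linear initial value problems by truncation -/

/-- Truncation of a real number to `[-r, r]`. -/
def clip (r x : ℝ) : ℝ := max (-r) (min r x)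

theorem abs_clip_sub_le (r x y : ℝ) : |clip r x - clip r y| ≤ |x - y| :=
  (abs_max_sub_max_le_max _ _ _ _).trans <| by
    rw [sub_self, abs_zero]
    refine max_le (abs_nonneg _) ((abs_min_sub_min_le_max _ _ _ _).trans ?_)
    simp

theorem abs_clip_le_abs {r : ℝ} (hr : 0 ≤ r) (x : ℝ) : |clip r x| ≤ |x| := by
  have := abs_clip_sub_le r x 0
  simpa [clip, hr] using this

theorem abs_clip_le {r : ℝ} (hr : 0 ≤ r) (x : ℝ) : |clip r x| ≤ r := by
  rw [abs_le, clip]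
  exact ⟨le_max_left _ _, max_le (by linarith) (min_le_left _ _)⟩

theorem clip_of_abs_le {r x : ℝ} (h : |x| ≤ r) : clip r x = x := by
  rw [abs_le] at h
  rw [clip, min_eq_right h.2, max_eq_right h.1]

/-- Global solvability of the initial value problem for a linear second-order equation. -/
theorem exists_linear_ivp {m : ℕ} {p q g : ℝ → ℝ} (hp : ContDiff ℝ m p) (hq : ContDiff ℝ m q)
    (hg : ContDiff ℝ m g) {a b : ℝ} (hab : a ≤ b) (y₀ z₀ : ℝ) :
    ∃ v z : ℝ → ℝ, ContDiffOn ℝ m v (Icc a b) ∧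
      (∀ t ∈ Icc a b, HasDerivWithinAt v (z t) (Icc a b) t) ∧
      (∀ t ∈ Icc a b, HasDerivWithinAt z (p t * z t + q t * v t + g t) (Icc a b) t) ∧
      v a = y₀ ∧ z a = z₀ := by
  obtain ⟨Mp, hMp⟩ := isCompact_Icc.exists_bound_of_continuousOn (s := Icc a b)
    hp.continuous.continuousOn
  obtain ⟨Mq, hMq⟩ := isCompact_Icc.exists_bound_of_continuousOn (s := Icc a b)
    hq.continuous.continuousOn
  obtain ⟨G, hG⟩ := isCompact_Icc.exists_bound_of_continuousOn (s := Icc a b)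
    hg.continuous.continuousOn
  simp only [Real.norm_eq_abs] at hMp hMq hG
  have ha : a ∈ Icc a b := left_mem_Icc.2 hab
  have hMp0 := (abs_nonneg _).trans (hMp a ha)
  have hMq0 := (abs_nonneg _).trans (hMq a ha)
  have hG0 := (abs_nonneg _).trans (hG a ha)
  -- In the sup norm on pairs, the summand `1` covers the component `v' = z`.
  set M := Mp + Mq + 1 with hM
  have hM0 : 0 < M := by positivity
  set δ := ‖(y₀, z₀)‖ with hδ
  have hδ0 : 0 ≤ δ := norm_nonneg _
  set r := gronwallBound δ M G (b - a) with hr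
  have hr0 : 0 ≤ r := by
    rw [hr, gronwallBound_of_K_ne_0 hM0.ne']
    have : 1 ≤ Real.exp (M * (b - a)) := Real.one_le_exp (mul_nonneg hM0.le (by linarith))
    have h1 : 0 ≤ Real.exp (M * (b - a)) - 1 := by linarith
    positivity
  -- Clipping makes the field globally bounded, so Picard–Lindelöf works on the whole interval at
  -- once. Its linear growth bound is unchanged, so Grönwall keeps the solution within `r`, where
  -- clipping is inactive.
  let F : ℝ → ℝ × ℝ → ℝ × ℝ := fun t y =>
    (clip r y.2, p t * clip r y.2 + q t * clip r y.1 + g t)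
  have hFle : ∀ t ∈ Icc a b, ∀ y : ℝ × ℝ, ∀ s, |clip r y.1| ≤ s → |clip r y.2| ≤ s →
      ‖F t y‖ ≤ M * s + G := by
    intro t ht y s h1 h2
    have hs : 0 ≤ s := (abs_nonneg _).trans h1
    refine max_le ?_ ?_
    · have e1 : s ≤ M * s := le_mul_of_one_le_left hs (by rw [hM]; linarith)
      exact h2.trans (by linarith)
    · have e1 : |p t * clip r y.2| ≤ Mp * s := by
        rw [abs_mul]
        exact mul_le_mul (hMp t ht) h2 (abs_nonneg _) hMp0
      have e2 : |q t * clip r y.1| ≤ Mq * s := by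
        rw [abs_mul]
        exact mul_le_mul (hMq t ht) h1 (abs_nonneg _) hMq0
      refine (abs_add_le _ _).trans ?_
      have e3 := abs_add_le (p t * clip r y.2) (q t * clip r y.1)
      have e4 := hG t ht
      rw [hM]
      linarith
  have hPL : IsPicardLindelof F (⟨a, ha⟩ : Icc a b) (y₀, z₀)
      (Real.toNNReal ((M * r + G) * (b - a))) 0 (Real.toNNReal (M * r + G)) (Real.toNNReal M) := by
    constructor
    · intro t ht
      refine LipschitzWith.lipschitzOnWith (LipschitzWith.of_dist_le_mul fun x y => ?_)
      rw [Real.coe_toNNReal _ hM0.le]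
      have h1 : |clip r x.1 - clip r y.1| ≤ dist x y :=
        (abs_clip_sub_le _ _ _).trans (le_max_left _ _)
      have h2 : |clip r x.2 - clip r y.2| ≤ dist x y :=
        (abs_clip_sub_le _ _ _).trans (le_max_right _ _)
      have hd : 0 ≤ dist x y := dist_nonneg
      refine max_le ?_ ?_
      · refine h2.trans (le_mul_of_one_le_left hd (by rw [hM]; linarith))
      · have e0 : p t * clip r x.2 + q t * clip r x.1 + g t
            - (p t * clip r y.2 + q t * clip r y.1 + g t)
            = p t * (clip r x.2 - clip r y.2) + q t * (clip r x.1 - clip r y.1) := by ring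
        change |p t * clip r x.2 + q t * clip r x.1 + g t
            - (p t * clip r y.2 + q t * clip r y.1 + g t)| ≤ M * dist x y
        rw [e0]
        refine (abs_add_le _ _).trans ?_
        rw [abs_mul, abs_mul]
        have e1 := mul_le_mul (hMp t ht) h2 (abs_nonneg _) hMp0
        have e2 := mul_le_mul (hMq t ht) h1 (abs_nonneg _) hMq0
        rw [hM]
        linarith
    · intro x _
      have h1 := hp.continuous
      have h2 := hq.continuous
      have h3 := hg.continuous
      exact Continuous.continuousOn (by fun_prop)
    · intro t ht x _
      rw [Real.coe_toNNReal _ (by positivity)]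
      exact hFle t ht x r (abs_clip_le hr0 _) (abs_clip_le hr0 _)
    · rw [Real.coe_toNNReal _ (by positivity),
        Real.coe_toNNReal _ (mul_nonneg (by positivity) (by linarith))]
      simp [hab]
  obtain ⟨y, hy0, hy⟩ := hPL.exists_eq_forall_mem_Icc_hasDerivWithinAt₀
  have hyr : ∀ t ∈ Icc a b, ‖y t‖ ≤ r := by
    intro t ht
    have h1 := norm_le_gronwallBound_of_norm_deriv_right_le (f := y) (f' := fun t => F t (y t))
      (δ := δ) (K := M) (ε := G) (a := a) (b := b)
      (fun t ht => (hy t ht).continuousWithinAt)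
      (fun t ht => (hy t (Ico_subset_Icc_self ht)).mono_of_mem_nhdsWithin
        (Icc_mem_nhdsGE_of_mem ht)) (congrArg norm hy0).le
      (fun t ht => hFle t (Ico_subset_Icc_self ht) (y t) _
        ((abs_clip_le_abs hr0 _).trans (norm_fst_le (y t)))
        ((abs_clip_le_abs hr0 _).trans (norm_snd_le (y t)))) t ht
    refine h1.trans (gronwallBound_mono hδ0 hG0 hM0.le ?_)
    linarith [ht.2]
  have hyc : ∀ t ∈ Icc a b, F t (y t) = ((y t).2, p t * (y t).2 + q t * (y t).1 + g t) := by
    intro t ht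
    have h1 := hyr t ht
    simp only [F]
    rw [clip_of_abs_le ((norm_fst_le (y t)).trans h1), clip_of_abs_le ((norm_snd_le (y t)).trans h1)]
  have hy' : ∀ t ∈ Icc a b, HasDerivWithinAt y
      ((fun (t : ℝ) (y : ℝ × ℝ) => (y.2, p t * y.2 + q t * y.1 + g t)) t (y t)) (Icc a b) t := by
    intro t ht
    have := hy t ht
    rwa [hyc t ht] at this
  have hsm : ContDiffOn ℝ ((m : ℕ∞) : WithTop ℕ∞) y (Icc a b) := by
    refine ODE.contDiffOn_enat_Icc_of_hasDerivWithinAt (u := univ)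
      (f := fun (t : ℝ) (y : ℝ × ℝ) => (y.2, p t * y.2 + q t * y.1 + g t)) ?_ hy' (fun _ _ => mem_univ _)
    refine ContDiff.contDiffOn ?_
    simp only [Function.uncurry_def]
    have hp' : ContDiff ℝ ((m : ℕ∞) : WithTop ℕ∞) p := hp
    have hq' : ContDiff ℝ ((m : ℕ∞) : WithTop ℕ∞) q := hq
    have hg' : ContDiff ℝ ((m : ℕ∞) : WithTop ℕ∞) g := hg
    fun_prop
  refine ⟨fun t => (y t).1, fun t => (y t).2, hsm.fst, fun t ht => (hy' t ht).fst,
    fun t ht => (hy' t ht).snd, by simp [hy0], by simp [hy0]⟩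

/-! ### Maximum principle with Robin conditions -/

theorem deriv_nonpos_of_max_left {w : ℝ → ℝ} {d a b : ℝ} (hab : a < b)
    (hw : HasDerivWithinAt w d (Icc a b) a) (hmax : ∀ x ∈ Icc a b, w x ≤ w a) : d ≤ 0 := by
  have h1 : Filter.Tendsto (slope w a) (nhdsWithin a (Ioc a b)) (nhds d) := by
    have := hasDerivWithinAt_iff_tendsto_slope.1 hw
    rwa [Icc_sdiff_left] at this
  have : (nhdsWithin a (Ioc a b)).NeBot := left_nhdsWithin_Ioc_neBot hab
  refine le_of_tendsto h1 ?_
  filter_upwards [self_mem_nhdsWithin] with x hx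
  rw [slope_def_field]
  exact div_nonpos_of_nonpos_of_nonneg (by linarith [hmax x (Ioc_subset_Icc_self hx)])
    (by linarith [hx.1])

theorem deriv_nonneg_of_max_right {w : ℝ → ℝ} {d a b : ℝ} (hab : a < b)
    (hw : HasDerivWithinAt w d (Icc a b) b) (hmax : ∀ x ∈ Icc a b, w x ≤ w b) : 0 ≤ d := by
  have h1 : Filter.Tendsto (slope w b) (nhdsWithin b (Ico a b)) (nhds d) := by
    have := hasDerivWithinAt_iff_tendsto_slope.1 hw
    rwa [Icc_sdiff_right] at this
  have : (nhdsWithin b (Ico a b)).NeBot := right_nhdsWithin_Ico_neBot hab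
  refine ge_of_tendsto h1 ?_
  filter_upwards [self_mem_nhdsWithin] with x hx
  rw [slope_def_field]
  exact div_nonneg_of_nonpos (by linarith [hmax x (Ico_subset_Icc_self hx)]) (by linarith [hx.2])

/-- If `d > 0`, the second derivative test makes `x` a local minimum as well, so `w` is locally
constant and `d = 0`. -/
theorem second_deriv_nonpos_of_isLocalMax {w w1 : ℝ → ℝ} {d x : ℝ}
    (hw : ∀ᶠ y in nhds x, HasDerivAt w (w1 y) y) (hw1 : HasDerivAt w1 d x) (hmax : IsLocalMax w x) :
    w1 x = 0 ∧ d ≤ 0 := by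
  have h0 : w1 x = 0 := hmax.hasDerivAt_eq_zero hw.self_of_nhds
  refine ⟨h0, ?_⟩
  by_contra! hd
  have hderiv : deriv w =ᶠ[nhds x] w1 := hw.mono fun y hy => hy.deriv
  have h2 : deriv (deriv w) x = d := by rw [hderiv.deriv_eq]; exact hw1.deriv
  have hmin : IsLocalMin w x := isLocalMin_of_deriv_deriv_pos (by rw [h2]; exact hd)
    (by rw [hderiv.eq_of_nhds]; exact h0) hw.self_of_nhds.continuousAt
  have hconst : w =ᶠ[nhds x] fun _ => w x := by
    filter_upwards [hmin, hmax] with y h1 h2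
    exact le_antisymm h2 h1
  have h3 : deriv (deriv w) x = 0 := by
    rw [hconst.deriv.deriv_eq]
    simp
  linarith

/-- Maximum principle for a second-order operator with Robin conditions. -/
theorem robin_le {w w1 w2 p c1 c0 : ℝ → ℝ} {a b κ H lL lR : ℝ} (hab : a < b) (hκ : 0 < κ)
    (hH : 0 ≤ H) (hlL : 0 < lL) (hlR : lR < 0)
    (hw : ∀ x ∈ Icc a b, HasDerivWithinAt w (w1 x) (Icc a b) x)
    (hw1 : ∀ x ∈ Icc a b, HasDerivWithinAt w1 (w2 x) (Icc a b) x)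
    (hp : ∀ x ∈ Icc a b, 0 ≤ p x) (hc0 : ∀ x ∈ Icc a b, κ ≤ c0 x)
    (hle : ∀ x ∈ Icc a b, -p x * w2 x + c1 x * w1 x + c0 x * w x ≤ H)
    (hL : w1 a = lL * w a) (hR : w1 b = lR * w b) : ∀ x ∈ Icc a b, w x ≤ H / κ := by
  intro x hx
  obtain ⟨y, hy, hmax⟩ := isCompact_Icc.exists_isMaxOn (nonempty_Icc.2 hab.le)
    (fun x hx => (hw x hx).continuousWithinAt : ContinuousOn w (Icc a b))
  refine (hmax hx).trans ?_
  have hHκ : 0 ≤ H / κ := by positivity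
  rcases le_or_gt (w y) 0 with h | hpos
  · exact h.trans hHκ
  -- A positive maximum at an end is excluded by the signs: `lL > 0` forces `w` to increase into the
  -- interval, and `lR < 0` forces it to decrease towards the right end.
  rcases hy.1.eq_or_lt with rfl | hay
  · have := deriv_nonpos_of_max_left hab (hw _ hy) (fun x hx => hmax hx)
    rw [hL] at this
    nlinarith
  rcases hy.2.eq_or_lt with rfl | hyb
  · have := deriv_nonneg_of_max_right hab (hw _ hy) (fun x hx => hmax hx)
    rw [hR] at this
    nlinarith
  have hnhds : Icc a b ∈ nhds y := Icc_mem_nhds hay hyb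
  obtain ⟨h1, h2⟩ := second_deriv_nonpos_of_isLocalMax (w := w) (w1 := w1) (d := w2 y) (x := y)
    (by
      filter_upwards [Ioo_mem_nhds hay hyb] with z hz
      exact (hw z (Ioo_subset_Icc_self hz)).hasDerivAt (Icc_mem_nhds hz.1 hz.2))
    ((hw1 y hy).hasDerivAt hnhds) (hmax.isLocalMax hnhds)
  have h3 := hle y hy
  rw [h1] at h3
  have h4 : κ * w y ≤ c0 y * w y := by gcongr; exact hc0 y hy
  have h5 : 0 ≤ p y * -w2 y := mul_nonneg (hp y hy) (by linarith)
  rw [le_div_iff₀ hκ]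
  linarith

theorem robin_abs_le {w w1 w2 p c1 c0 : ℝ → ℝ} {a b κ H lL lR : ℝ} (hab : a < b) (hκ : 0 < κ)
    (hH : 0 ≤ H) (hlL : 0 < lL) (hlR : lR < 0)
    (hw : ∀ x ∈ Icc a b, HasDerivWithinAt w (w1 x) (Icc a b) x)
    (hw1 : ∀ x ∈ Icc a b, HasDerivWithinAt w1 (w2 x) (Icc a b) x)
    (hp : ∀ x ∈ Icc a b, 0 ≤ p x) (hc0 : ∀ x ∈ Icc a b, κ ≤ c0 x)
    (hle : ∀ x ∈ Icc a b, |-p x * w2 x + c1 x * w1 x + c0 x * w x| ≤ H)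
    (hL : w1 a = lL * w a) (hR : w1 b = lR * w b) : ∀ x ∈ Icc a b, |w x| ≤ H / κ := by
  intro x hx
  rw [abs_le']
  refine ⟨robin_le hab hκ hH hlL hlR hw hw1 hp hc0 (fun x hx => (abs_le.1 (hle x hx)).2) hL hR x hx,
    ?_⟩
  refine robin_le (w := fun x => -w x) (w1 := fun x => -w1 x) (w2 := fun x => -w2 x) (p := p)
    (c1 := c1) (c0 := c0) hab hκ hH hlL hlR (fun x hx => (hw x hx).neg) (fun x hx => (hw1 x hx).neg)
    hp hc0 (fun x hx => ?_) (by rw [hL]; ring) (by rw [hR]; ring) x hx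
  have := (abs_le.1 (hle x hx)).1
  linarith

/-! ### The differentiated equation and uniform derivative bounds -/

theorem iteratedDerivWithin_iteratedDerivWithin {f : ℝ → ℝ} {s : Set ℝ} (i j : ℕ) :
    iteratedDerivWithin i (iteratedDerivWithin j f s) s = iteratedDerivWithin (i + j) f s := by
  induction i with
  | zero => simp
  | succ i ih =>
    ext x
    rw [iteratedDerivWithin_succ, ih, show i + 1 + j = i + j + 1 by omega, iteratedDerivWithin_succ]

theorem hasDerivWithinAt_iteratedDerivWithin_Icc {v : ℝ → ℝ} {n k : ℕ} {l r : ℝ} (hlr : l < r)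
    (hv : ContDiffOn ℝ n v (Icc l r)) (hk : k < n) {t : ℝ} (ht : t ∈ Icc l r) :
    HasDerivWithinAt (iteratedDerivWithin k v (Icc l r))
      (iteratedDerivWithin (k + 1) v (Icc l r) t) (Icc l r) t := by
  rw [iteratedDerivWithin_succ]
  exact ((hv.differentiableOn_iteratedDerivWithin (by exact_mod_cast hk) (uniqueDiffOn_Icc hlr)) t ht
    |>.hasDerivWithinAt)

theorem contDiffOn_iteratedDerivWithin {v : ℝ → ℝ} {n k j : ℕ} {l r : ℝ} (hlr : l < r)
    (hv : ContDiffOn ℝ n v (Icc l r)) (hk : k + j ≤ n) :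
    ContDiffOn ℝ k (iteratedDerivWithin j v (Icc l r)) (Icc l r) := by
  induction j generalizing k with
  | zero => simpa using hv.of_le (by exact_mod_cast hk)
  | succ j ih =>
    have h1 : iteratedDerivWithin (j + 1) v (Icc l r)
        = derivWithin (iteratedDerivWithin j v (Icc l r)) (Icc l r) :=
      iteratedDerivWithin_succ
    rw [h1]
    exact (ih (k := k + 1) (by omega)).derivWithin (uniqueDiffOn_Icc hlr) (by norm_cast)

/-- The differential equation differentiated `k` times. -/
theorem leibniz_of_eqn {P Q G v : ℝ → ℝ} {ε μ l r : ℝ} {n k : ℕ} (hlr : l < r)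
    (hP : ContDiffOn ℝ n P (Icc l r)) (hQ : ContDiffOn ℝ n Q (Icc l r))
    (hv : ContDiffOn ℝ (n + 2 : ℕ) v (Icc l r)) (hk : k ≤ n)
    (heq : ∀ x ∈ Icc l r, -(ε * P x) * iteratedDerivWithin 2 v (Icc l r) x
      + μ * iteratedDerivWithin 1 v (Icc l r) x + Q x * v x = G x) :
    ∀ x ∈ Icc l r,
      -ε * ∑ i ∈ Finset.range (k + 1), k.choose i * iteratedDerivWithin i P (Icc l r) x
          * iteratedDerivWithin (k - i + 2) v (Icc l r) x
        + μ * iteratedDerivWithin (k + 1) v (Icc l r) x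
        + ∑ i ∈ Finset.range (k + 1), k.choose i * iteratedDerivWithin i Q (Icc l r) x
          * iteratedDerivWithin (k - i) v (Icc l r) x
      = iteratedDerivWithin k G (Icc l r) x := by
  intro x hx
  have hu := uniqueDiffOn_Icc hlr
  have c0 : ContDiffWithinAt ℝ k v (Icc l r) x :=
    (hv.of_le (by exact_mod_cast (by omega : k ≤ n + 2))) x hx
  have c1 : ContDiffWithinAt ℝ k (iteratedDerivWithin 1 v (Icc l r)) (Icc l r) x :=
    contDiffOn_iteratedDerivWithin hlr hv (by omega) x hx
  have c2 : ContDiffWithinAt ℝ k (iteratedDerivWithin 2 v (Icc l r)) (Icc l r) x :=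
    contDiffOn_iteratedDerivWithin hlr hv (by omega) x hx
  have cP : ContDiffWithinAt ℝ k P (Icc l r) x := (hP.of_le (by exact_mod_cast hk)) x hx
  have cQ : ContDiffWithinAt ℝ k Q (Icc l r) x := (hQ.of_le (by exact_mod_cast hk)) x hx
  set F : ℝ → ℝ := fun x => -ε * (P * iteratedDerivWithin 2 v (Icc l r)) x with hF
  set H : ℝ → ℝ := fun x => μ * iteratedDerivWithin 1 v (Icc l r) x with hH
  have hG : EqOn (F + H + Q * v) G (Icc l r) := by
    intro y hy
    simp only [Pi.add_apply, Pi.mul_apply, hF, hH]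
    rw [← heq y hy]
    ring
  have d1 : ContDiffWithinAt ℝ k F (Icc l r) x := contDiffWithinAt_const.mul (cP.mul c2)
  have d2 : ContDiffWithinAt ℝ k H (Icc l r) x := contDiffWithinAt_const.mul c1
  have d12 : ContDiffWithinAt ℝ k (F + H) (Icc l r) x := d1.add d2
  have dQ : ContDiffWithinAt ℝ k (Q * v) (Icc l r) x := cQ.mul c0
  rw [← iteratedDerivWithin_congr hG hx, iteratedDerivWithin_add hx hu d12 dQ,
    iteratedDerivWithin_add hx hu d1 d2, hF, hH, iteratedDerivWithin_const_mul_field,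
    iteratedDerivWithin_const_mul_field, iteratedDerivWithin_mul hx hu cP c2,
    iteratedDerivWithin_mul hx hu cQ c0]
  simp only [iteratedDerivWithin_iteratedDerivWithin]

theorem iteratedDerivWithin_eq_zero_of_eventually_const {P : ℝ → ℝ} {s : Set ℝ} {x c : ℝ} {i : ℕ}
    (hx : x ∈ s) (h : P =ᶠ[nhdsWithin x s] fun _ => c) (hi : i ≠ 0) :
    iteratedDerivWithin i P s x = 0 := by
  rw [h.iteratedDerivWithin_eq (h.eq_of_nhdsWithin hx), iteratedDerivWithin_const, if_neg hi]

/-- A Robin condition matched to constant coefficients is inherited by all derivatives. -/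
theorem robin_iteratedDerivWithin {P Q G v : ℝ → ℝ} {ε μ l r x lam q : ℝ} {n : ℕ} (hlr : l < r)
    (hε : 0 < ε) (hP : ContDiffOn ℝ n P (Icc l r)) (hQ : ContDiffOn ℝ n Q (Icc l r))
    (hv : ContDiffOn ℝ (n + 2 : ℕ) v (Icc l r))
    (heq : ∀ x ∈ Icc l r, -(ε * P x) * iteratedDerivWithin 2 v (Icc l r) x
      + μ * iteratedDerivWithin 1 v (Icc l r) x + Q x * v x = G x)
    (hx : x ∈ Icc l r) (hPx : P =ᶠ[nhdsWithin x (Icc l r)] fun _ => 1)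
    (hQx : Q =ᶠ[nhdsWithin x (Icc l r)] fun _ => q)
    (hGx : G =ᶠ[nhdsWithin x (Icc l r)] fun _ => 0) (hlam : ε * lam ^ 2 = μ * lam + q)
    (h0 : iteratedDerivWithin 1 v (Icc l r) x = lam * v x) :
    ∀ k ≤ n, iteratedDerivWithin (k + 1) v (Icc l r) x
      = lam * iteratedDerivWithin k v (Icc l r) x := by
  intro k
  induction k with
  | zero => intro _; simpa using h0
  | succ k ih =>
    intro hk
    have h1 := ih (by omega)
    have h2 := leibniz_of_eqn hlr hP hQ hv (by omega : k ≤ n) heq x hx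
    have h3 : iteratedDerivWithin k G (Icc l r) x = 0 := by
      rw [hGx.iteratedDerivWithin_eq (hGx.eq_of_nhdsWithin hx), iteratedDerivWithin_const]
      simp
    rw [h3, Finset.sum_eq_single_of_mem 0 (by simp) (fun i _ hi => by
        rw [iteratedDerivWithin_eq_zero_of_eventually_const hx hPx hi]; ring),
      Finset.sum_eq_single_of_mem 0 (by simp) (fun i _ hi => by
        rw [iteratedDerivWithin_eq_zero_of_eventually_const hx hQx hi]; ring)] at h2
    simp only [Nat.choose_zero_right, Nat.cast_one, iteratedDerivWithin_zero, Nat.sub_zero,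
      hPx.eq_of_nhdsWithin hx, hQx.eq_of_nhdsWithin hx, h1] at h2
    -- Near `x` the differentiated equation is `ε v⁽ᵏ⁺²⁾ = μ v⁽ᵏ⁺¹⁾ + q v⁽ᵏ⁾`. By the condition at
    -- level `k` and the characteristic equation, the right side is `ε λ² v⁽ᵏ⁾ = ε λ v⁽ᵏ⁺¹⁾`.
    have h4 : ε * iteratedDerivWithin (k + 1 + 1) v (Icc l r) x
        = ε * (lam * iteratedDerivWithin (k + 1) v (Icc l r) x) := by
      rw [h1]
      linear_combination -h2 - hlam * iteratedDerivWithin k v (Icc l r) x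
    exact mul_left_cancel₀ hε.ne' h4

/-- `v` solves `-ε P v'' + μ v' + Q v = G` on `[l, r]`, with Robin conditions of the right sign for
`v` and its derivatives. -/
structure IsRobinSolution (P Q G : ℝ → ℝ) (ε μ l r : ℝ) (n : ℕ) (v : ℝ → ℝ) : Prop where
  contDiffOn : ContDiffOn ℝ (n + 2 : ℕ) v (Icc l r)
  eqn : ∀ x ∈ Icc l r, -(ε * P x) * iteratedDerivWithin 2 v (Icc l r) x
      + μ * iteratedDerivWithin 1 v (Icc l r) x + Q x * v x = G x
  left : ∃ lam : ℝ, 0 < lam ∧ ∀ k ≤ n, iteratedDerivWithin (k + 1) v (Icc l r) l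
      = lam * iteratedDerivWithin k v (Icc l r) l
  right : ∃ lam : ℝ, lam < 0 ∧ ∀ k ≤ n, iteratedDerivWithin (k + 1) v (Icc l r) r
      = lam * iteratedDerivWithin k v (Icc l r) r

theorem abs_sum_range_le {u : ℕ → ℝ} {k : ℕ} {T : ℝ} (h : ∀ i < k, |u i| ≤ T) :
    |∑ i ∈ Finset.range k, u i| ≤ k * T := by
  refine (Finset.abs_sum_le_sum_abs _ _).trans ?_
  have := Finset.sum_le_card_nsmul (Finset.range k) (fun i => |u i|) T
    (fun i hi => h i (Finset.mem_range.1 hi))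
  simpa using this

/-- For `j > k` the binomial coefficient vanishes, so bounds on the factors are needed only for `j ≤
k`. This allows Leibniz sums to be padded with terms that have no meaning. -/
theorem abs_choose_mul_le {n k j : ℕ} {x y B K : ℝ} (hk : k ≤ n) (hx : j ≤ k → |x| ≤ B)
    (hy : j ≤ k → |y| ≤ K) (hB : 0 ≤ B) (hK : 0 ≤ K) : |k.choose j * x * y| ≤ 2 ^ n * B * K := by
  rcases le_or_gt j k with h | h
  · rw [abs_mul, abs_mul, Nat.abs_cast]
    have h1 : (k.choose j : ℝ) ≤ 2 ^ n := by
      have : k.choose j ≤ 2 ^ n := (Nat.choose_le_two_pow k j).trans (Nat.pow_le_pow_right two_pos hk)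
      exact_mod_cast this
    have := hx h
    have := hy h
    gcongr
  · rw [Nat.choose_eq_zero_of_lt h]
    simp
    positivity

theorem exists_iteratedDerivWithin_bound {g : ℝ → ℝ} {l r : ℝ} {n : ℕ} (hlr : l < r)
    (hg : ContDiffOn ℝ n g (Icc l r)) :
    ∃ B : ℝ, 0 ≤ B ∧ ∀ k ≤ n, ∀ x ∈ Icc l r, |iteratedDerivWithin k g (Icc l r) x| ≤ B := by
  have h : ∀ k, ∃ B : ℝ, k ≤ n → ∀ x ∈ Icc l r, |iteratedDerivWithin k g (Icc l r) x| ≤ B := by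
    intro k
    by_cases hk : k ≤ n
    · obtain ⟨B, hB⟩ := isCompact_Icc.exists_bound_of_continuousOn
        (contDiffOn_iteratedDerivWithin (k := 0) (j := k) hlr hg (by omega)).continuousOn
      exact ⟨B, fun _ => hB⟩
    · exact ⟨0, fun h => absurd h hk⟩
  choose B hB using h
  refine ⟨∑ k ∈ Finset.range (n + 1), |B k|, by positivity, fun k hk x hx => ?_⟩
  refine (hB k hk x hx).trans ((le_abs_self _).trans ?_)
  exact Finset.single_le_sum (f := fun k => |B k|) (fun _ _ => abs_nonneg _) (by simp; omega)

/-- Uniform bound for one more derivative. -/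
theorem IsRobinSolution.bound_succ {P Q G v : ℝ → ℝ} {ε μ l r B K κ p₀ : ℝ} {n k : ℕ} (hlr : l < r)
    (hP : ContDiffOn ℝ n P (Icc l r)) (hQ : ContDiffOn ℝ n Q (Icc l r))
    (hB0 : 0 ≤ B) (hK : 0 ≤ K) (hκ : 0 < κ) (hp₀ : 0 < p₀)
    (hBP : ∀ k ≤ n, ∀ x ∈ Icc l r, |iteratedDerivWithin k P (Icc l r) x| ≤ B)
    (hBQ : ∀ k ≤ n, ∀ x ∈ Icc l r, |iteratedDerivWithin k Q (Icc l r) x| ≤ B)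
    (hBG : ∀ k ≤ n, ∀ x ∈ Icc l r, |iteratedDerivWithin k G (Icc l r) x| ≤ B)
    (hPp : ∀ x ∈ Icc l r, p₀ ≤ P x) (hQκ : ∀ x ∈ Icc l r, κ ≤ Q x)
    (hε : 0 < ε) (hε1 : ε ≤ 1) (hμ : 0 ≤ μ) (hμ1 : μ ≤ 1)
    (hv : IsRobinSolution P Q G ε μ l r n v) (hk : k ≤ n)
    (hlow : ∀ j < k, ∀ x ∈ Icc l r, |iteratedDerivWithin j v (Icc l r) x| ≤ K) :
    ∀ x ∈ Icc l r, |iteratedDerivWithin k v (Icc l r) x|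
      ≤ (B + 2 * (n * (2 ^ n * B * K))) / (κ / 2)
        + 2 ^ n * B * (B + K + 2 * ((n + 1) * (2 ^ n * B * K))) / (κ / 2 * p₀) := by
  set D := fun j => iteratedDerivWithin j v (Icc l r) with hD
  set T := 2 ^ n * B * K with hT
  have hT0 : 0 ≤ T := by positivity
  have hkn : (k : ℝ) ≤ n := by exact_mod_cast hk
  have hfirst : 0 ≤ (B + 2 * (n * T)) / (κ / 2) := by positivity
  have hsecond : 0 ≤ 2 ^ n * B * (B + K + 2 * ((n + 1) * T)) / (κ / 2 * p₀) := by positivity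
  intro x hx
  -- The `k`-th derivative solves an equation with zero-order coefficient `Q - ε (k choose 2) P''`.
  -- If `k ≤ 1` or `ε` is small, this is at least `κ/2` and the maximum principle applies. Constant
  -- convection matters here: a variable coefficient would contribute a further term of size `μ`.
  by_cases hcase : k ≤ 1 ∨ ε * (2 ^ n * B) ≤ κ / 2
  · obtain ⟨lL, hlL, hL⟩ := hv.left
    obtain ⟨lR, hlR, hR⟩ := hv.right
    have key := robin_abs_le (w := D k) (w1 := D (k + 1)) (w2 := D (k + 2)) (p := fun x => ε * P x)
      (c1 := fun x => μ - ε * (k * iteratedDerivWithin 1 P (Icc l r) x))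
      (c0 := fun x => Q x - ε * (k.choose 2 * iteratedDerivWithin 2 P (Icc l r) x))
      (κ := κ / 2) (H := B + 2 * (n * T)) hlr (by positivity) (by positivity) hlL hlR
      (fun x hx => hasDerivWithinAt_iteratedDerivWithin_Icc hlr hv.contDiffOn (by omega) hx)
      (fun x hx => hasDerivWithinAt_iteratedDerivWithin_Icc hlr hv.contDiffOn (by omega) hx)
      (fun x hx => mul_nonneg hε.le (hp₀.le.trans (hPp x hx))) ?_ ?_ (hL k hk) (hR k hk) x hx
    · linarith
    · intro x hx
      have h1 : ε * (k.choose 2 * iteratedDerivWithin 2 P (Icc l r) x) ≤ κ / 2 := by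
        rcases hcase with h | h
        · rw [Nat.choose_eq_zero_of_lt (by omega)]
          simp
          positivity
        · rcases lt_or_ge k 2 with h2 | h2
          · rw [Nat.choose_eq_zero_of_lt h2]
            simp
            positivity
          · refine le_trans ?_ h
            have h3 := abs_choose_mul_le (n := n) (k := k) (j := 2) (B := B) (K := 1) (y := 1) hk
              (fun _ => hBP 2 (by omega) x hx) (fun _ => by simp) hB0 zero_le_one
            rw [mul_one, mul_one] at h3
            exact mul_le_mul_of_nonneg_left ((le_abs_self _).trans h3) hε.le
      have := hQκ x hx
      linarith
    · intro x hx
      have hL := leibniz_of_eqn hlr hP hQ hv.contDiffOn hk hv.eqn x hx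
      have e1 : ∑ i ∈ Finset.range (k + 1), (k.choose i : ℝ) * iteratedDerivWithin i P (Icc l r) x
            * iteratedDerivWithin (k - i + 2) v (Icc l r) x
          = (∑ i ∈ Finset.range k, (k.choose (i + 3) : ℝ) * iteratedDerivWithin (i + 3) P (Icc l r) x
            * D (k - (i + 3) + 2) x) + k.choose 2 * iteratedDerivWithin 2 P (Icc l r) x * D k x
            + k * iteratedDerivWithin 1 P (Icc l r) x * D (k + 1) x + P x * D (k + 2) x := by
        -- Padding the sum to `k + 3` terms lets the three leading terms be split off even when `k <
        -- 2`.
        have h1 : ∑ i ∈ Finset.range (k + 1), (k.choose i : ℝ) * iteratedDerivWithin i P (Icc l r) x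
              * iteratedDerivWithin (k - i + 2) v (Icc l r) x
            = ∑ i ∈ Finset.range (k + 3), (k.choose i : ℝ) * iteratedDerivWithin i P (Icc l r) x
              * iteratedDerivWithin (k - i + 2) v (Icc l r) x := by
          refine Finset.sum_subset (fun i hi => ?_) (fun i _ hi => ?_)
          · simp at hi ⊢; omega
          · rw [Nat.choose_eq_zero_of_lt (by simp at hi; omega)]; simp
        rw [h1, Finset.sum_range_succ', Finset.sum_range_succ', Finset.sum_range_succ']
        have h2 : (k.choose 2 : ℝ) * iteratedDerivWithin 2 P (Icc l r) x
            * iteratedDerivWithin (k - 2 + 2) v (Icc l r) x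
            = k.choose 2 * iteratedDerivWithin 2 P (Icc l r) x * D k x := by
          rcases lt_or_ge k 2 with h | h
          · rw [Nat.choose_eq_zero_of_lt h]; simp
          · rw [show k - 2 + 2 = k by omega]
        have h3 : (k.choose 1 : ℝ) * iteratedDerivWithin 1 P (Icc l r) x
            * iteratedDerivWithin (k - 1 + 2) v (Icc l r) x
            = k * iteratedDerivWithin 1 P (Icc l r) x * D (k + 1) x := by
          rcases Nat.eq_zero_or_pos k with h | h
          · subst h; simp
          · rw [show k - 1 + 2 = k + 1 by omega, Nat.choose_one_right]
        simp only [zero_add, Nat.reduceAdd, add_assoc, h2, h3]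
        simp [hD]
      have e2 : ∑ i ∈ Finset.range (k + 1), (k.choose i : ℝ) * iteratedDerivWithin i Q (Icc l r) x
            * iteratedDerivWithin (k - i) v (Icc l r) x
          = (∑ i ∈ Finset.range k, (k.choose (i + 1) : ℝ) * iteratedDerivWithin (i + 1) Q (Icc l r) x
            * D (k - (i + 1)) x) + Q x * D k x := by
        rw [Finset.sum_range_succ']
        simp [hD]
      rw [e1, e2] at hL
      have b1 : |∑ i ∈ Finset.range k, (k.choose (i + 3) : ℝ)
          * iteratedDerivWithin (i + 3) P (Icc l r) x * D (k - (i + 3) + 2) x| ≤ k * T :=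
        abs_sum_range_le fun i hi => abs_choose_mul_le hk (fun h => hBP _ (by omega) x hx)
          (fun h => hlow _ (by omega) x hx) hB0 hK
      have b2 : |∑ i ∈ Finset.range k, (k.choose (i + 1) : ℝ)
          * iteratedDerivWithin (i + 1) Q (Icc l r) x * D (k - (i + 1)) x| ≤ k * T :=
        abs_sum_range_le fun i hi => abs_choose_mul_le hk (fun h => hBQ _ (by omega) x hx)
          (fun h => hlow _ (by omega) x hx) hB0 hK
      set S1 := ∑ i ∈ Finset.range k, (k.choose (i + 3) : ℝ)
          * iteratedDerivWithin (i + 3) P (Icc l r) x * D (k - (i + 3) + 2) x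
      set S2 := ∑ i ∈ Finset.range k, (k.choose (i + 1) : ℝ)
          * iteratedDerivWithin (i + 1) Q (Icc l r) x * D (k - (i + 1)) x
      have e3 : -(ε * P x) * D (k + 2) x
          + (μ - ε * (k * iteratedDerivWithin 1 P (Icc l r) x)) * D (k + 1) x
          + (Q x - ε * (k.choose 2 * iteratedDerivWithin 2 P (Icc l r) x)) * D k x
          = iteratedDerivWithin k G (Icc l r) x + ε * S1 - S2 := by
        have e4 : D (k + 1) x = iteratedDerivWithin (k + 1) v (Icc l r) x := rfl
        rw [e4] at hL ⊢
        linear_combination hL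
      rw [e3]
      have b3 := hBG k hk x hx
      have b4 : |ε * S1| ≤ k * T := by
        rw [abs_mul, abs_of_pos hε]
        exact (mul_le_of_le_one_left (abs_nonneg _) hε1).trans b1
      have b5 : k * T ≤ n * T := by gcongr
      refine (abs_sub _ _).trans ?_
      have := abs_add_le (iteratedDerivWithin k G (Icc l r) x) (ε * S1)
      linarith
  -- Now `ε` is bounded below, so the equation differentiated `k - 2` times can be solved for the
  -- `k`-th derivative.
  · push Not at hcase
    obtain ⟨j, rfl⟩ : ∃ j, k = j + 2 := ⟨k - 2, by omega⟩
    have hL := leibniz_of_eqn hlr hP hQ hv.contDiffOn (by omega : j ≤ n) hv.eqn x hx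
    rw [Finset.sum_range_succ'] at hL
    simp only [Nat.choose_zero_right, Nat.cast_one, one_mul, Nat.sub_zero,
      iteratedDerivWithin_zero] at hL
    have hjn : (j : ℝ) ≤ n := by exact_mod_cast (by omega : j ≤ n)
    have b1 : |∑ i ∈ Finset.range j, (j.choose (i + 1) : ℝ)
        * iteratedDerivWithin (i + 1) P (Icc l r) x
        * iteratedDerivWithin (j - (i + 1) + 2) v (Icc l r) x| ≤ j * T :=
      abs_sum_range_le fun i hi => abs_choose_mul_le (by omega) (fun h => hBP _ (by omega) x hx)
        (fun h => hlow _ (by omega) x hx) hB0 hK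
    have b2 : |∑ i ∈ Finset.range (j + 1), (j.choose i : ℝ)
        * iteratedDerivWithin i Q (Icc l r) x
        * iteratedDerivWithin (j - i) v (Icc l r) x| ≤ (j + 1 : ℕ) * T :=
      abs_sum_range_le fun i hi => abs_choose_mul_le (by omega) (fun h => hBQ _ (by omega) x hx)
        (fun h => hlow _ (by omega) x hx) hB0 hK
    have b3 := hBG j (by omega) x hx
    have b4 := hlow (j + 1) (by omega) x hx
    set S1 := ∑ i ∈ Finset.range j, (j.choose (i + 1) : ℝ)
        * iteratedDerivWithin (i + 1) P (Icc l r) x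
        * iteratedDerivWithin (j - (i + 1) + 2) v (Icc l r) x
    set S2 := ∑ i ∈ Finset.range (j + 1), (j.choose i : ℝ)
        * iteratedDerivWithin i Q (Icc l r) x
        * iteratedDerivWithin (j - i) v (Icc l r) x
    have e3 : ε * P x * D (j + 2) x = μ * iteratedDerivWithin (j + 1) v (Icc l r) x
        - ε * S1 + S2 - iteratedDerivWithin j G (Icc l r) x := by
      have e4 : D (j + 2) x = iteratedDerivWithin (j + 2) v (Icc l r) x := rfl
      rw [e4]
      linear_combination -hL
    have b5 : |ε * S1| ≤ (n + 1) * T := by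
      rw [abs_mul, abs_of_pos hε]
      refine (mul_le_of_le_one_left (abs_nonneg _) hε1).trans (b1.trans ?_)
      gcongr
      linarith
    have b6 : |μ * iteratedDerivWithin (j + 1) v (Icc l r) x| ≤ K := by
      rw [abs_mul, abs_of_nonneg hμ]
      exact (mul_le_of_le_one_left (abs_nonneg _) hμ1).trans b4
    have b7 : |S2| ≤ (n + 1) * T := by
      refine b2.trans ?_
      push_cast
      gcongr
    have b8 : ε * P x * |D (j + 2) x| ≤ B + K + 2 * ((n + 1) * T) := by
      have h1 : ε * P x * |D (j + 2) x| = |ε * P x * D (j + 2) x| := by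
        rw [abs_mul, abs_of_pos (mul_pos hε (hp₀.trans_le (hPp x hx)))]
      rw [h1, e3]
      rw [abs_le] at b3 b5 b6 b7 ⊢
      constructor <;> linarith
    have b9 : ε * p₀ * |D (j + 2) x| ≤ B + K + 2 * ((n + 1) * T) := by
      refine le_trans ?_ b8
      have := hPp x hx
      gcongr
    have b10 : |D (j + 2) x| ≤ 2 ^ n * B * (B + K + 2 * ((n + 1) * T)) / (κ / 2 * p₀) := by
      rw [le_div_iff₀ (by positivity)]
      calc |D (j + 2) x| * (κ / 2 * p₀) ≤ |D (j + 2) x| * (ε * (2 ^ n * B) * p₀) := by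
            have := hcase.2.le
            gcongr
        _ = 2 ^ n * B * (ε * p₀ * |D (j + 2) x|) := by ring
        _ ≤ _ := by gcongr
    exact b10.trans (by linarith)

/-- Uniform bounds for all derivatives of the Robin solutions. -/
theorem exists_robin_solution_bound {P Q G : ℝ → ℝ} {l r κ p₀ : ℝ} {n : ℕ} (hlr : l < r)
    (hP : ContDiffOn ℝ n P (Icc l r)) (hQ : ContDiffOn ℝ n Q (Icc l r))
    (hG : ContDiffOn ℝ n G (Icc l r)) (hκ : 0 < κ) (hp₀ : 0 < p₀)
    (hPp : ∀ x ∈ Icc l r, p₀ ≤ P x) (hQκ : ∀ x ∈ Icc l r, κ ≤ Q x) :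
    ∃ K : ℝ, 0 ≤ K ∧ ∀ ε μ : ℝ, 0 < ε → ε ≤ 1 → 0 ≤ μ → μ ≤ 1 →
      ∀ v : ℝ → ℝ, IsRobinSolution P Q G ε μ l r n v →
      ∀ k ≤ n, ∀ x ∈ Icc l r, |iteratedDerivWithin k v (Icc l r) x| ≤ K := by
  obtain ⟨B1, hB1, hBP⟩ := exists_iteratedDerivWithin_bound hlr hP
  obtain ⟨B2, hB2, hBQ⟩ := exists_iteratedDerivWithin_bound hlr hQ
  obtain ⟨B3, hB3, hBG⟩ := exists_iteratedDerivWithin_bound hlr hG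
  set B := B1 + B2 + B3 with hB
  have hB0 : 0 ≤ B := by positivity
  suffices h : ∀ m ≤ n + 1, ∃ K : ℝ, 0 ≤ K ∧ ∀ ε μ : ℝ, 0 < ε → ε ≤ 1 → 0 ≤ μ → μ ≤ 1 →
      ∀ v : ℝ → ℝ, IsRobinSolution P Q G ε μ l r n v →
      ∀ k < m, ∀ x ∈ Icc l r, |iteratedDerivWithin k v (Icc l r) x| ≤ K by
    obtain ⟨K, hK, h1⟩ := h (n + 1) le_rfl
    exact ⟨K, hK, fun ε μ a b c d v hv k hk => h1 ε μ a b c d v hv k (by omega)⟩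
  intro m
  induction m with
  | zero => intro _; exact ⟨0, le_rfl, by simp⟩
  | succ m ih =>
    intro hm
    obtain ⟨K, hK, h1⟩ := ih (by omega)
    set K' := (B + 2 * (n * (2 ^ n * B * K))) / (κ / 2)
        + 2 ^ n * B * (B + K + 2 * ((n + 1) * (2 ^ n * B * K))) / (κ / 2 * p₀) with hK'
    have hK'0 : 0 ≤ K' := by positivity
    refine ⟨K + K', by positivity, ?_⟩
    intro ε μ hε hε1 hμ hμ1 v hv k hk x hx
    rcases (Nat.lt_succ_iff.1 hk).lt_or_eq with h | rfl
    · exact (h1 ε μ hε hε1 hμ hμ1 v hv k h x hx).trans (by linarith)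
    · have := hv.bound_succ hlr hP hQ hB0 hK hκ hp₀
        (fun k hk x hx => (hBP k hk x hx).trans (by linarith))
        (fun k hk x hx => (hBQ k hk x hx).trans (by linarith))
        (fun k hk x hx => (hBG k hk x hx).trans (by linarith)) hPp hQκ hε hε1 hμ hμ1
        (by omega : k ≤ n) (h1 ε μ hε hε1 hμ hμ1 v hv) x hx
      rw [← hK'] at this
      linarith

/-! ### Existence of Robin solutions -/

/-- Solvability of the Robin problem. -/
theorem exists_robin_solution {P Q G : ℝ → ℝ} {l r κ q ε μ : ℝ} {n : ℕ} (hlr : l < r)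
    (hP : ContDiff ℝ (n + 2 : ℕ) P) (hQ : ContDiff ℝ (n + 2 : ℕ) Q) (hG : ContDiff ℝ (n + 2 : ℕ) G)
    (hκ : 0 < κ) (hq : 0 < q) (hP0 : ∀ x, 0 < P x) (hQκ : ∀ x ∈ Icc l r, κ ≤ Q x)
    (hPl : P =ᶠ[nhds l] fun _ => 1) (hPr : P =ᶠ[nhds r] fun _ => 1)
    (hQl : Q =ᶠ[nhds l] fun _ => q) (hQr : Q =ᶠ[nhds r] fun _ => q)
    (hGl : G =ᶠ[nhds l] fun _ => 0) (hGr : G =ᶠ[nhds r] fun _ => 0)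
    (hε : 0 < ε) :
    ∃ v : ℝ → ℝ, IsRobinSolution P Q G ε μ l r n v := by
  -- The Robin constants are the roots of `ε λ² = μ λ + q`; since `q > 0` they have opposite signs.
  set S := Real.sqrt (μ ^ 2 + 4 * ε * q) with hS
  have hS2 : S ^ 2 = μ ^ 2 + 4 * ε * q := Real.sq_sqrt (by positivity)
  have hSμ : |μ| < S := by
    rw [hS, ← Real.sqrt_sq_eq_abs]
    exact Real.sqrt_lt_sqrt (sq_nonneg _) (by have : 0 < 4 * ε * q := by positivity
                                              linarith)
  rw [abs_lt] at hSμ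
  set lL := (μ + S) / (2 * ε) with hlL
  set lR := (μ - S) / (2 * ε) with hlR
  have hlL0 : 0 < lL := div_pos (by linarith) (by positivity)
  have hlR0 : lR < 0 := div_neg_of_neg_of_pos (by linarith) (by positivity)
  have hlL2 : ε * lL ^ 2 = μ * lL + q := by
    rw [hlL]; field_simp; linear_combination hS2
  have hlR2 : ε * lR ^ 2 = μ * lR + q := by
    rw [hlR]; field_simp; linear_combination hS2
  have hPne : ∀ x, ε * P x ≠ 0 := fun x => (mul_pos hε (hP0 x)).ne'
  have hεP : ContDiff ℝ (n + 2 : ℕ) fun x => ε * P x := contDiff_const.mul hP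
  have c1 : ContDiff ℝ (n + 2 : ℕ) fun x => μ / (ε * P x) := contDiff_const.div hεP hPne
  have c2 : ContDiff ℝ (n + 2 : ℕ) fun x => Q x / (ε * P x) := hQ.div hεP hPne
  have c3 : ContDiff ℝ (n + 2 : ℕ) fun x => -G x / (ε * P x) := hG.neg.div hεP hPne
  have c4 : ContDiff ℝ (n + 2 : ℕ) fun _ : ℝ => (0 : ℝ) := contDiff_const
  obtain ⟨u, u1, hu, hu1, hu2, hul, hul'⟩ := exists_linear_ivp c1 c2 c4 hlr.le 1 lL
  obtain ⟨y, y1, hy, hy1, hy2, hyl, hyl'⟩ := exists_linear_ivp c1 c2 c3 hlr.le 0 0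
  -- Shooting from the left: `u` solves the homogeneous equation with the left Robin condition. If
  -- it satisfied the right one too, the maximum principle would give `u = 0`, contrary to `u l =
  -- 1`.
  have hne : u1 r - lR * u r ≠ 0 := by
    intro h
    have := robin_abs_le (w := u) (w1 := u1) (p := fun x => ε * P x) (c1 := fun _ => μ) (c0 := Q)
      (H := 0) (lL := lL) (lR := lR) hlr hκ le_rfl hlL0 hlR0 hu1 hu2
      (fun x _ => (mul_pos hε (hP0 x)).le) hQκ (fun x _ => ?_) (by rw [hul, hul', mul_one])
      (by linarith) l (left_mem_Icc.2 hlr.le)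
    · rw [hul] at this
      norm_num at this
    · have := (hP0 x).ne'
      have h0 : -(ε * P x) * (μ / (ε * P x) * u1 x + Q x / (ε * P x) * u x + 0) + μ * u1 x
          + Q x * u x = 0 := by
        field_simp
        ring
      rw [h0, abs_zero]
  set c := -(y1 r - lR * y r) / (u1 r - lR * u r) with hc
  have hcr : c * (u1 r - lR * u r) = -(y1 r - lR * y r) := div_mul_cancel₀ _ hne
  set v := fun x => y x + c * u x with hv
  set v1 := fun x => y1 x + c * u1 x with hv1
  have hud := uniqueDiffOn_Icc hlr
  have hd1 : ∀ x ∈ Icc l r, iteratedDerivWithin 1 v (Icc l r) x = v1 x := by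
    intro x hx
    rw [iteratedDerivWithin_one]
    exact ((hy1 x hx).add ((hu1 x hx).const_mul c)).derivWithin (hud x hx)
  have hd2 : ∀ x ∈ Icc l r, iteratedDerivWithin 2 v (Icc l r) x
      = (μ / (ε * P x) * y1 x + Q x / (ε * P x) * y x + -G x / (ε * P x))
        + c * (μ / (ε * P x) * u1 x + Q x / (ε * P x) * u x + 0) := by
    intro x hx
    rw [iteratedDerivWithin_succ, derivWithin_congr hd1 (hd1 x hx)]
    exact ((hy2 x hx).add ((hu2 x hx).const_mul c)).derivWithin (hud x hx)
  have hvc : ContDiffOn ℝ (n + 2 : ℕ) v (Icc l r) := hy.add (contDiffOn_const.mul hu)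
  have heq : ∀ x ∈ Icc l r, -(ε * P x) * iteratedDerivWithin 2 v (Icc l r) x
      + μ * iteratedDerivWithin 1 v (Icc l r) x + Q x * v x = G x := by
    intro x hx
    have := (hP0 x).ne'
    rw [hd1 x hx, hd2 x hx]
    simp only [hv, hv1]
    field_simp
    ring
  have hPn : ContDiffOn ℝ n P (Icc l r) := (hP.of_le (by norm_cast; omega)).contDiffOn
  have hQn : ContDiffOn ℝ n Q (Icc l r) := (hQ.of_le (by norm_cast; omega)).contDiffOn
  have hl := left_mem_Icc.2 hlr.le
  have hr := right_mem_Icc.2 hlr.le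
  refine ⟨v, hvc, heq, ⟨lL, hlL0, ?_⟩, ⟨lR, hlR0, ?_⟩⟩
  · refine robin_iteratedDerivWithin hlr hε hPn hQn hvc heq hl (hPl.filter_mono nhdsWithin_le_nhds)
      (hQl.filter_mono nhdsWithin_le_nhds) (hGl.filter_mono nhdsWithin_le_nhds) hlL2 ?_
    rw [hd1 l hl]
    simp only [hv, hv1, hul, hul', hyl, hyl']
    ring
  · refine robin_iteratedDerivWithin hlr hε hPn hQn hvc heq hr (hPr.filter_mono nhdsWithin_le_nhds)
      (hQr.filter_mono nhdsWithin_le_nhds) (hGr.filter_mono nhdsWithin_le_nhds) hlR2 ?_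
    rw [hd1 r hr]
    simp only [hv, hv1]
    linear_combination hcr

/-! ### Extension, cutoff and the regular component -/

/-- A `C^n` function on a compact interval extends to a `C^n` function on the line. -/
theorem exists_contDiff_extension {n : ℕ} {g : ℝ → ℝ} {l r : ℝ} (hlr : l < r)
    (hg : ContDiffOn ℝ n g (Icc l r)) : ∃ G : ℝ → ℝ, ContDiff ℝ n G ∧ EqOn G g (Icc l r) := by
  induction n generalizing g with
  | zero =>
    refine ⟨IccExtend hlr.le ((Icc l r).domRestrict g), ?_, fun x hx => ?_⟩
    · have : Continuous ((Icc l r).domRestrict g) :=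
        continuousOn_iff_continuous_domRestrict.1 hg.continuousOn
      exact contDiff_zero.2 this.Icc_extend'
    · rw [IccExtend_of_mem _ _ hx]
      rfl
  | succ n ih =>
    have hu := uniqueDiffOn_Icc hlr
    -- The derivative is extended and then integrated; on `[l, r]` the difference to `g` has zero
    -- derivative and vanishes at `l`.
    obtain ⟨G, hG, hGe⟩ := ih (hg.derivWithin hu (by norm_cast))
    have hF : ∀ x, HasDerivAt (fun x => g l + ∫ t in l..x, G t) (G x) x := fun x =>
      (intervalIntegral.integral_hasDerivAt_right (hG.continuous.intervalIntegrable _ _)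
        (hG.continuous.stronglyMeasurableAtFilter _ _) hG.continuous.continuousAt).const_add _
    refine ⟨fun x => g l + ∫ t in l..x, G t, ?_, fun x hx => ?_⟩
    · push_cast
      rw [contDiff_succ_iff_deriv]
      refine ⟨fun x => (hF x).differentiableAt, by simp, ?_⟩
      rwa [funext fun x => (hF x).deriv]
    · have hsub : uIcc l x ⊆ Icc l r := uIcc_subset_Icc (left_mem_Icc.2 hlr.le) hx
      have hd : ∀ t ∈ Icc l r, HasDerivWithinAt g (derivWithin g (Icc l r) t) (Icc l r) t :=
        fun t ht => ((hg.differentiableOn (by norm_cast)) t ht).hasDerivWithinAt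
      have := abs_sub_le_mul_of_deriv (f := fun x => (g l + ∫ t in l..x, G t) - g x)
        (f' := fun t => G t - derivWithin g (Icc l r) t) (x := l) (y := x) (C := 0)
        (fun t ht => (hF t).hasDerivWithinAt.sub ((hd t (hsub ht)).mono hsub))
        (fun t ht => by rw [hGe (hsub ht), sub_self, abs_zero])
      simp only [intervalIntegral.integral_same, add_zero, sub_self, sub_zero, zero_mul] at this
      exact sub_eq_zero.1 (abs_nonpos_iff.1 this)

/-- A smooth cutoff that equals `1` on `[0, 1]` and is supported in a given neighbourhood. -/
theorem exists_unit_cutoff {U : Set ℝ} (hU : IsOpen U) (h01 : Icc 0 1 ⊆ U) :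
    ∃ χ : ℝ → ℝ, (∀ n : ℕ, ContDiff ℝ n χ) ∧ (∀ x, 0 ≤ χ x) ∧ (∀ x, χ x ≤ 1) ∧
      (∀ x ∈ Icc (0 : ℝ) 1, χ x = 1) ∧ (∀ x, χ x ≠ 0 → x ∈ U) ∧
      (∀ x, x ≤ -1 / 2 → χ x = 0) ∧ (∀ x, 3 / 2 ≤ x → χ x = 0) := by
  obtain ⟨δ, hδ, hδU⟩ := isCompact_Icc.exists_thickening_subset_open hU h01
  -- The cap `1/2` makes the cutoff vanish near `-1` and `2`, the ends of the larger interval.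
  set d := min δ (1 / 2) with hd
  have hd0 : 0 < d := lt_min hδ (by norm_num)
  have hd1 : d ≤ 1 / 2 := min_le_right _ _
  have hdδ : d ≤ δ := min_le_left _ _
  have hz1 : ∀ x, x ≤ -d → Real.smoothTransition ((x + d) / d) = 0 := fun x hx =>
    Real.smoothTransition.zero_of_nonpos (div_nonpos_of_nonpos_of_nonneg (by linarith) hd0.le)
  have hz2 : ∀ x, 1 + d ≤ x → Real.smoothTransition ((1 + d - x) / d) = 0 := fun x hx =>
    Real.smoothTransition.zero_of_nonpos (div_nonpos_of_nonpos_of_nonneg (by linarith) hd0.le)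
  refine ⟨fun x => Real.smoothTransition ((x + d) / d) * Real.smoothTransition ((1 + d - x) / d),
    fun n => ?_, fun x => ?_, fun x => ?_, fun x hx => ?_, fun x hx => ?_, fun x hx => ?_,
    fun x hx => ?_⟩
  · refine ContDiff.mul ?_ ?_
    · exact Real.smoothTransition.contDiff.comp (by fun_prop)
    · exact Real.smoothTransition.contDiff.comp (by fun_prop)
  · exact mul_nonneg (Real.smoothTransition.nonneg _) (Real.smoothTransition.nonneg _)
  · exact mul_le_one₀ (Real.smoothTransition.le_one _) (Real.smoothTransition.nonneg _)
      (Real.smoothTransition.le_one _)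
  · simp only
    rw [Real.smoothTransition.one_of_one_le, Real.smoothTransition.one_of_one_le, mul_one]
    · rw [le_div_iff₀ hd0]; linarith [hx.2]
    · rw [le_div_iff₀ hd0]; linarith [hx.1]
  · have h1 : -d < x := by
      by_contra h
      exact hx (by simp only; rw [hz1 x (by linarith), zero_mul])
    have h2 : x < 1 + d := by
      by_contra h
      exact hx (by simp only; rw [hz2 x (by linarith), mul_zero])
    apply hδU
    rw [Metric.mem_thickening_iff]
    rcases le_total x 0 with h | h
    · exact ⟨0, by simp, by rw [Real.dist_eq, abs_lt]; constructor <;> linarith⟩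
    rcases le_total x 1 with h' | h'
    · exact ⟨x, ⟨h, h'⟩, by simpa using hδ⟩
    · exact ⟨1, by simp, by rw [Real.dist_eq, abs_lt]; constructor <;> linarith⟩
  · simp only
    rw [hz1 x (by linarith), zero_mul]
  · simp only
    rw [hz2 x (by linarith), mul_zero]

theorem le_on_unit_of_lt {g h : ℝ → ℝ} (hg : ContinuousOn g (Icc 0 1)) (hh : ContinuousOn h (Icc 0 1))
    (hlt : ∀ x ∈ Ioo (0 : ℝ) 1, g x < h x) : ∀ x ∈ Icc (0 : ℝ) 1, g x ≤ h x := by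
  rw [← closure_Ioo (zero_ne_one' ℝ)] at hg hh ⊢
  intro x hx
  exact le_on_closure (fun x hx => (hlt x hx).le) hg hh hx

/-- Uniformly smooth solutions of the two-parameter equation exist. -/
theorem exists_regular_component {a b f : ℝ → ℝ} {α γ : ℝ} (hα : 0 < α) (hγ : 0 < γ)
    (ha : ContDiffOn ℝ 7 a (Icc 0 1)) (hb : ContDiffOn ℝ 7 b (Icc 0 1))
    (hf : ContDiffOn ℝ 7 f (Icc 0 1)) (haα : ∀ x ∈ Ioo (0 : ℝ) 1, α < a x)
    (hbγ : ∀ x ∈ Ioo (0 : ℝ) 1, γ * a x < b x) :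
    ∃ K : ℝ, ∀ ε μ : ℝ, 0 < ε → ε ≤ 1 → 0 ≤ μ → μ ≤ 1 →
      ∃ v : ℝ → ℝ, IsRegularComponent a b f α γ ε μ K v := by
  have haα' := le_on_unit_of_lt continuousOn_const ha.continuousOn haα
  have hbγ' : ∀ x ∈ Icc (0 : ℝ) 1, γ * a x ≤ b x := le_on_unit_of_lt (continuousOn_const.mul ha.continuousOn) hb.continuousOn hbγ
  have ha0 : ∀ x ∈ Icc (0 : ℝ) 1, 0 < a x := fun x hx => hα.trans_le (haα' x hx)
  have hane : ∀ x ∈ Icc (0 : ℝ) 1, a x ≠ 0 := fun x hx => (ha0 x hx).ne'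
  have hs1 : ContDiffOn ℝ (7 : ℕ) (fun x => 1 / a x) (Icc 0 1) := contDiffOn_const.div ha hane
  have hs2 : ContDiffOn ℝ (7 : ℕ) (fun x => b x / a x) (Icc 0 1) := ContDiffOn.div hb ha hane
  have hs3 : ContDiffOn ℝ (7 : ℕ) (fun x => f x / a x) (Icc 0 1) := ContDiffOn.div hf ha hane
  obtain ⟨P₁, hP₁, hP₁e⟩ := exists_contDiff_extension one_pos hs1
  obtain ⟨Q₁, hQ₁, hQ₁e⟩ := exists_contDiff_extension one_pos hs2
  obtain ⟨G₁, hG₁, hG₁e⟩ := exists_contDiff_extension one_pos hs3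
  -- The extensions need not stay positive far from `[0, 1]`. The cutoff lives where they do and
  -- blends them with the constants `1`, `γ` and `0`, keeping `P > 0` and `Q ≥ γ/2`.
  obtain ⟨χ, hχ, hχ0, hχ1, hχI, hχU, hχl, hχr⟩ := exists_unit_cutoff
    (U := {x | 0 < P₁ x} ∩ {x | γ / 2 < Q₁ x})
    ((isOpen_lt continuous_const hP₁.continuous).inter
      (isOpen_lt continuous_const hQ₁.continuous))
    (fun x hx => ⟨by
        simp only [mem_ofPred_eq]; rw [hP₁e hx]
        have := ha0 x hx
        positivity, by
        simp only [mem_ofPred_eq]; rw [hQ₁e hx, lt_div_iff₀ (ha0 x hx)]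
        nlinarith [hbγ' x hx, mul_pos hγ (ha0 x hx)]⟩)
  set P : ℝ → ℝ := fun x => χ x * P₁ x + (1 - χ x) * 1 with hP
  set Q : ℝ → ℝ := fun x => χ x * Q₁ x + (1 - χ x) * γ with hQ
  set G : ℝ → ℝ := fun x => χ x * G₁ x with hG
  have hPc : ContDiff ℝ (5 + 2 : ℕ) P :=
    ((hχ 7).mul hP₁).add ((contDiff_const.sub (hχ 7)).mul contDiff_const)
  have hQc : ContDiff ℝ (5 + 2 : ℕ) Q :=
    ((hχ 7).mul hQ₁).add ((contDiff_const.sub (hχ 7)).mul contDiff_const)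
  have hGc : ContDiff ℝ (5 + 2 : ℕ) G := (hχ 7).mul hG₁
  have hP0 : ∀ x, 0 < P x := by
    intro x
    by_cases h : χ x = 0
    · simp [hP, h]
    · have h1 := (hχU x h).1
      have h2 : 0 < χ x * P₁ x := mul_pos ((hχ0 x).lt_of_ne' h) h1
      have h3 := hχ1 x
      simp only [hP]
      linarith
  have hQκ : ∀ x, γ / 2 ≤ Q x := by
    intro x
    by_cases h : χ x = 0
    · simp only [hQ, h]; linarith
    · have h1 : γ / 2 < Q₁ x := (hχU x h).2
      have h2 : χ x * (γ / 2) ≤ χ x * Q₁ x := mul_le_mul_of_nonneg_left h1.le (hχ0 x)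
      have h3 := hχ1 x
      simp only [hQ]
      nlinarith
  have hnl : ∀ᶠ x in nhds (-1 : ℝ), χ x = 0 := by
    filter_upwards [Iio_mem_nhds (by norm_num : (-1 : ℝ) < -1 / 2)] with x hx
    exact hχl x hx.le
  have hnr : ∀ᶠ x in nhds (2 : ℝ), χ x = 0 := by
    filter_upwards [Ioi_mem_nhds (by norm_num : (3 / 2 : ℝ) < 2)] with x hx
    exact hχr x (le_of_lt hx)
  have hlr : (-1 : ℝ) < 2 := by norm_num
  obtain ⟨p₀, hp₀, hPp⟩ : ∃ p₀, 0 < p₀ ∧ ∀ x ∈ Icc (-1 : ℝ) 2, p₀ ≤ P x := by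
    obtain ⟨y, _, hmin⟩ := isCompact_Icc.exists_isMinOn (nonempty_Icc.2 hlr.le)
      hPc.continuous.continuousOn
    exact ⟨P y, hP0 y, fun x hx => hmin hx⟩
  have h57 : ((5 : ℕ) : WithTop ℕ∞) ≤ ((5 + 2 : ℕ) : WithTop ℕ∞) := by norm_cast
  obtain ⟨K, hK, hbound⟩ := exists_robin_solution_bound hlr (hPc.of_le h57).contDiffOn
    (hQc.of_le h57).contDiffOn (hGc.of_le h57).contDiffOn (half_pos hγ) hp₀ hPp
    (fun x _ => hQκ x)
  refine ⟨K, fun ε μ hε hε1 hμ hμ1 => ?_⟩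
  obtain ⟨v, hv⟩ := exists_robin_solution (n := 5) (μ := μ) (q := γ) hlr hPc hQc hGc (half_pos hγ) hγ
    hP0 (fun x _ => hQκ x) (hnl.mono fun x hx => by simp [hP, hx])
    (hnr.mono fun x hx => by simp [hP, hx]) (hnl.mono fun x hx => by simp [hQ, hx])
    (hnr.mono fun x hx => by simp [hQ, hx]) (hnl.mono fun x hx => by simp [hG, hx])
    (hnr.mono fun x hx => by simp [hG, hx]) hε
  have hsub : Icc (0 : ℝ) 1 ⊆ Icc (-1) 2 := Icc_subset_Icc (by norm_num) (by norm_num)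
  -- `[0, 1]` is interior to `[-1, 2]`, so both within-derivatives equal the ordinary one, even at
  -- `0` and `1`.
  have hres : ∀ k ≤ 5, ∀ x ∈ Icc (0 : ℝ) 1, iteratedDerivWithin k v (Icc 0 1) x
      = iteratedDerivWithin k v (Icc (-1) 2) x := by
    intro k hk x hx
    have hcd : ContDiffAt ℝ k v x :=
      ((hv.contDiffOn.of_le (by norm_cast; omega)) x (hsub hx)).contDiffAt
        (Icc_mem_nhds (by linarith [hx.1]) (by linarith [hx.2]))
    rw [iteratedDerivWithin_eq_iteratedDeriv (uniqueDiffOn_Icc one_pos) hcd hx,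
      iteratedDerivWithin_eq_iteratedDeriv (uniqueDiffOn_Icc hlr) hcd (hsub hx)]
  refine ⟨v, (hv.contDiffOn.of_le h57).mono hsub, fun x hx => ?_, fun k hk x hx => ?_⟩
  · have hx' := Ioo_subset_Icc_self hx
    have h1 := hv.eqn x (hsub hx')
    have hax := hane x hx'
    simp only [hP, hQ, hG, hχI x hx', hP₁e hx', hQ₁e hx', hG₁e hx'] at h1
    rw [diffOp, hres 2 (by norm_num) x hx', hres 1 (by norm_num) x hx']
    field_simp at h1
    linear_combination h1
  · rw [hres k hk x hx]
    refine (hbound ε μ hε hε1 hμ hμ1 v hv k hk x (hsub hx)).trans ?_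
    have : 0 ≤ Real.sqrt (ε / theta α γ ε μ) ^ ((3 : ℤ) - (k : ℤ)) :=
      zpow_nonneg (Real.sqrt_nonneg _) _
    exact le_mul_of_one_le_right hK (by linarith)

end TwoParam

/-! ### Assembly -/

theorem theorem9 (a b f : ℝ → ℝ) (α γ : ℝ) (hα : 0 < α) (hγ : 0 < γ)
    (ha : ContDiffOn ℝ 7 a (Set.Icc 0 1))
    (hb : ContDiffOn ℝ 9 b (Set.Icc 0 1))
    (hf : ContDiffOn ℝ 9 f (Set.Icc 0 1))
    (haα : ∀ x ∈ Set.Ioo (0 : ℝ) 1, α < a x)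
    (hbγ : ∀ x ∈ Set.Ioo (0 : ℝ) 1, γ * a x < b x) :
    (∃ K : ℝ, ∀ ε μ : ℝ, 0 < ε → ε ≤ 1 → 0 ≤ μ → μ ≤ 1 →
      ∃ v : ℝ → ℝ, TwoParam.IsRegularComponent a b f α γ ε μ K v) ∧
    (∀ K : ℝ, ∃ C : ℝ, ∀ ε μ : ℝ, 0 < ε → ε ≤ 1 → 0 ≤ μ → μ ≤ 1 →
      ∀ v : ℝ → ℝ, TwoParam.IsRegularComponent a b f α γ ε μ K v →
      ∀ N : ℕ, 0 < N → 4 ∣ N →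
        TwoParam.sigmaR α γ ε μ N ≤ TwoParam.sigmaL α γ ε μ N →
        TwoParam.sigmaL α γ ε μ N < 1 / 4 →
        (∃ V : ℕ → ℝ, TwoParam.IsDiscreteRegularComponent a b f ε μ N
          (TwoParam.shishkin α γ ε μ N) v V) ∧
        ∀ V : ℕ → ℝ, TwoParam.IsDiscreteRegularComponent a b f ε μ N
            (TwoParam.shishkin α γ ε μ N) v V →
          ∀ i : ℕ, 1 ≤ i → i ≤ N →
            (TwoParam.shishkin α γ ε μ N i ≤ TwoParam.sigmaL α γ ε μ N →
              |TwoParam.dMinus (TwoParam.shishkin α γ ε μ N)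
                (fun j => V j - v (TwoParam.shishkin α γ ε μ N j)) i| ≤ C * (N : ℝ)⁻¹) ∧
            (TwoParam.sigmaL α γ ε μ N < TwoParam.shishkin α γ ε μ N i →
              TwoParam.shishkin α γ ε μ N i ≤ 1 - TwoParam.sigmaR α γ ε μ N →
              |TwoParam.dMinus (TwoParam.shishkin α γ ε μ N)
                (fun j => V j - v (TwoParam.shishkin α γ ε μ N j)) i|
                ≤ C * (N : ℝ)⁻¹ * Real.log N ^ 2) ∧
            (1 - TwoParam.sigmaR α γ ε μ N < TwoParam.shishkin α γ ε μ N i →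
              Real.sqrt (ε / TwoParam.theta α γ ε μ) *
                |TwoParam.dMinus (TwoParam.shishkin α γ ε μ N)
                  (fun j => V j - v (TwoParam.shishkin α γ ε μ N j)) i|
                ≤ C * (N : ℝ)⁻¹ * Real.log N ^ 2)) := by
  refine ⟨TwoParam.exists_regular_component hα hγ ha (hb.of_le (by norm_cast))
    (hf.of_le (by norm_cast)) haα hbγ, fun K => ?_⟩
  obtain ⟨C, hC0, hC⟩ := TwoParam.discrete_regular_component_error f hα hγ ha.continuousOn
    hb.continuousOn haα hbγ K
  refine ⟨C, fun ε μ hε hε1 hμ hμ1 v hv N hN hN4 hRL hL => ?_⟩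
  obtain ⟨n, rfl⟩ := hN4
  have hn : 0 < n := by omega
  have hn' : (0 : ℝ) < n := by exact_mod_cast hn
  obtain ⟨hex, herr⟩ := hC ε μ hε hε1 hμ hμ1 v hv n hn hRL hL
  refine ⟨hex, fun V hV i h1 h2 => ?_⟩
  obtain ⟨hcoarse, hfine⟩ := herr V hV i h1 h2
  have hR0 : 0 < TwoParam.sigmaR α γ ε μ (4 * n) := TwoParam.sigmaR_pos hn
  -- Translates position into index. It also serves the first estimate, since `σ_L ≤ 1 - σ_R`.
  have hleft : TwoParam.shishkin α γ ε μ (4 * n) i ≤ 1 - TwoParam.sigmaR α γ ε μ (4 * n) →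
      i ≤ 3 * n := by
    intro h
    by_contra! hi
    have h3 : TwoParam.shishkin α γ ε μ (4 * n) i
        = 1 - (4 * (n : ℝ) - i) * (TwoParam.sigmaR α γ ε μ (4 * n) / n) :=
      TwoParam.meshPoint_right hn hi.le
    have h4 : (4 * (n : ℝ) - i) * (TwoParam.sigmaR α γ ε μ (4 * n) / n)
        < n * (TwoParam.sigmaR α γ ε μ (4 * n) / n) := by
      have : (3 * n : ℝ) < i := by exact_mod_cast hi
      have : 0 < TwoParam.sigmaR α γ ε μ (4 * n) / n := by positivity
      gcongr
      linarith
    rw [mul_div_cancel₀ _ hn'.ne'] at h4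
    linarith
  have hlog : 1 ≤ Real.log ((4 * n : ℕ) : ℝ) ^ 2 := one_le_pow₀ (TwoParam.one_le_log_four_mul hn)
  have hCN : 0 ≤ C * ((4 * n : ℕ) : ℝ)⁻¹ := by positivity
  have hlast : C * ((4 * n : ℕ) : ℝ)⁻¹
      ≤ C * ((4 * n : ℕ) : ℝ)⁻¹ * Real.log ((4 * n : ℕ) : ℝ) ^ 2 :=
    le_mul_of_one_le_right hCN hlog
  exact ⟨fun h => hcoarse (hleft (by linarith)), fun _ h => (hcoarse (hleft h)).trans hlast,
    fun _ => hfine.trans hlast⟩
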